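/- **Setting.** Let $Z\in\mathbb R^K$, $E\in\mathbb R^p$, $\varepsilon\in\mathbb R$ be independent, mean-zero, square-integrable random variables, with $\Sigma_Z=\operatorname{Cov}(Z)$, $\Sigma_E=\operatorname{Cov}(E)$, $\sigma_\varepsilon^2=\operatorname{Var}(\varepsilon)$. Let $A\in\mathbb R^{p\times K}$, $\beta\in\mathbb R^K$, and let $X=AZ+E$, $y=Z^\top\beta+\varepsilon$ (the factor regression model). The training data are built from $n$ i.i.d. copies $(Z_i,E_i,\varepsilon_i)$ of $(Z,E,\varepsilon)$, independent of the new observation $(Z,E,\varepsilon)$, by $X_i=AZ_i+E_i$, $y_i=Z_i^\top\beta+\varepsilon_i$. Write $\mathbf X\in\mathbb R^{n\times p}$, $\mathbf Z\in\mathbb R^{n\times K}$ for the matrices with rows $X_i$, $Z_i$, and $\mathbf y=(y_i)_i$, $\boldsymbol\varepsilon=(\varepsilon_i)_i$. Let $\widehat\alpha$ be the vector of smallest Euclidean norm among the minimizers of $u\mapsto\|\mathbf Xu-\mathbf y\|$, let $\widehat\beta=\mathbf Z^+\mathbf y$, where $\mathbf Z^+$ is the Moore–Penrose pseudo-inverse,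 and let $R(\alpha)=\mathbb E_{(X,y)}[(X^\top\alpha-y)^2]$, so that $R(\widehat\alpha)$ is the prediction risk given the training data. $\mathbb E_{\boldsymbol\varepsilon}$ denotes expectation over the training noise $\boldsymbol\varepsilon$ only, with the training features and factors held fixed. **Theorem.** Suppose that $\Sigma_E=0$ and that $A$ and $\Sigma_Z$ both have rank $K$. 1. Almost surely on the event that $\mathbf Z$ has rank $K$, $X^\top\widehat\alpha=Z^\top\widehat\beta$ and $$R(\widehat\alpha)=\mathbb E_{(X,y)}[(X^\top\widehat\alpha-y)^2]=\mathbb E_{(Z,y)}[(Z^\top\widehat\beta-y)^2].$$ 2. Suppose in addition that $Z=\Sigma_Z^{1/2}\tilde Z$ and $\varepsilon=\sigma_\varepsilon\tilde\varepsilon$ almost surely, where $\tilde Z$ and $\tilde\varepsilon$ have mean zero and sub-Gaussian norm at most $L$. (Here $\|U\|_{\psi_2}=\inf\{t>0:\mathbb E\,e^{U^2/t^2}\le 2\}$ for real $U$, and $\|W\|_{\psi_2}=\sup_{\|v\|=1}\|v^\top W\|_{\psi_2}$ for a random vector $W$.) There are constants $C,c,c_1,c_2>0$, depending only on $L$, such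 that if $n>CK$, then with probability at least $1-c/n$ the matrix $\mathbf Z$ has rank $K$ and $$R(\widehat\alpha)-\sigma_\varepsilon^2\le c_1\,\sigma_\varepsilon^2\,\frac{K\log n}{n},\qquad \mathbb E_{\boldsymbol\varepsilon}[R(\widehat\alpha)]-\sigma_\varepsilon^2\ge c_2\,\sigma_\varepsilon^2\,\frac Kn ,$$ where the expectation $\mathbb E_{\boldsymbol\varepsilon}[R(\widehat\alpha)]$ is finite. -/

import Mathlib

open MeasureTheory ProbabilityTheory Matrix
open scoped ENNReal

noncomputable section

namespace FactorRegression

/-! ### The Moore-Penrose pseudo-inverse of a real matrix -/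

section Pinv

variable {m n : Type*} [Fintype m] [Fintype n]

/-- The four Penrose conditions: `P` is the Moore-Penrose pseudo-inverse of `B`. -/
structure IsPinv (B : Matrix m n ℝ) (P : Matrix n m ℝ) : Prop where
  mul_mul : B * P * B = B
  mul_mul' : P * B * P = P
  symm : (B * P).IsSymm
  symm' : (P * B).IsSymm

theorem IsPinv.unique {B : Matrix m n ℝ} {P Q : Matrix n m ℝ} (hP : IsPinv B P)
    (hQ : IsPinv B Q) : P = Q := by
  have e1 : B * P = B * Q := by
    have h1 : (B * Q) * (B * P) = B * P := by
      rw [← Matrix.mul_assoc, hQ.mul_mul]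
    have h2 : (B * P) * (B * Q) = B * Q := by
      rw [← Matrix.mul_assoc, hP.mul_mul]
    have h3 := congrArg Matrix.transpose h1
    rw [Matrix.transpose_mul, hP.symm.eq, hQ.symm.eq, h2] at h3
    exact h3.symm
  have e2 : P * B = Q * B := by
    have h1 : (P * B) * (Q * B) = P * B := by
      rw [Matrix.mul_assoc, ← Matrix.mul_assoc B, hQ.mul_mul]
    have h2 : (Q * B) * (P * B) = Q * B := by
      rw [Matrix.mul_assoc, ← Matrix.mul_assoc B, hP.mul_mul]
    have h3 := congrArg Matrix.transpose h1
    rw [Matrix.transpose_mul, hP.symm'.eq, hQ.symm'.eq, h2] at h3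
    exact h3.symm
  calc P = P * B * P := hP.mul_mul'.symm
    _ = Q * B * Q := by rw [e2, Matrix.mul_assoc, e1, ← Matrix.mul_assoc]
    _ = Q := hQ.mul_mul'

theorem exists_isPinv [DecidableEq n] (B : Matrix m n ℝ) : ∃ P, IsPinv B P := by
  have hG : (Bᵀ * B).IsHermitian := by
    simpa [Matrix.conjTranspose_eq_transpose_of_trivial] using
      Matrix.isHermitian_conjTranspose_mul_self B
  obtain ⟨U, d, hU, hU', hGd⟩ : ∃ (U : Matrix n n ℝ) (d : n → ℝ), U * Uᵀ = 1 ∧ Uᵀ * U = 1 ∧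
      Bᵀ * B = U * diagonal d * Uᵀ := by
    refine ⟨hG.eigenvectorUnitary, hG.eigenvalues, ?_, ?_, ?_⟩
    · simpa [star_eq_conjTranspose, Matrix.conjTranspose_eq_transpose_of_trivial] using
        Unitary.coe_mul_star_self hG.eigenvectorUnitary
    · simpa [star_eq_conjTranspose, Matrix.conjTranspose_eq_transpose_of_trivial] using
        Unitary.coe_star_mul_self hG.eigenvectorUnitary
    · have := hG.spectral_theorem
      simpa [Unitary.conjStarAlgAut_apply, star_eq_conjTranspose,
        Matrix.conjTranspose_eq_transpose_of_trivial, Function.comp_def] using this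
  set H : Matrix n n ℝ := U * diagonal (fun i => (d i)⁻¹) * Uᵀ with hH
  have cancel : ∀ a b : n → ℝ, (U * diagonal a * Uᵀ) * (U * diagonal b * Uᵀ)
      = U * diagonal (fun i => a i * b i) * Uᵀ := by
    intro a b
    calc (U * diagonal a * Uᵀ) * (U * diagonal b * Uᵀ)
        = U * diagonal a * (Uᵀ * U) * diagonal b * Uᵀ := by simp only [Matrix.mul_assoc]
      _ = _ := by rw [hU', Matrix.mul_one, Matrix.mul_assoc U, diagonal_mul_diagonal]
  have symm : ∀ a : n → ℝ, (U * diagonal a * Uᵀ)ᵀ = U * diagonal a * Uᵀ := by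
    intro a; simp [Matrix.transpose_mul, Matrix.mul_assoc]
  have GHG : (Bᵀ * B) * H * (Bᵀ * B) = Bᵀ * B := by
    rw [hGd, hH, cancel, cancel]; congr; ext i
    by_cases h : d i = 0 <;> simp [h]
  have HGH : H * (Bᵀ * B) * H = H := by
    rw [hGd, hH, cancel, cancel]; congr; ext i
    by_cases h : d i = 0 <;> simp [h]
  have key : B * H * (Bᵀ * B) = B := by
    rw [← sub_eq_zero, ← Matrix.conjTranspose_mul_self_eq_zero,
      Matrix.conjTranspose_eq_transpose_of_trivial]
    have : (B * H * (Bᵀ * B) - B) = B * (H * (Bᵀ * B) - 1) := by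
      rw [Matrix.mul_sub, Matrix.mul_one, Matrix.mul_assoc]
    have h0 : Bᵀ * (B * (H * (Bᵀ * B) - 1)) = 0 := by
      rw [← Matrix.mul_assoc, Matrix.mul_sub, ← Matrix.mul_assoc, GHG, Matrix.mul_one, sub_self]
    rw [this, Matrix.transpose_mul, Matrix.mul_assoc, h0, Matrix.mul_zero]
  refine ⟨H * Bᵀ, ?_, ?_, ?_, ?_⟩
  · rw [Matrix.mul_assoc, Matrix.mul_assoc, ← Matrix.mul_assoc, key]
  · calc H * Bᵀ * B * (H * Bᵀ) = (H * (Bᵀ * B) * H) * Bᵀ := by simp only [Matrix.mul_assoc]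
      _ = _ := by rw [HGH]
  · have hHs : Hᵀ = H := by rw [hH]; exact symm _
    simp [Matrix.IsSymm, Matrix.transpose_mul, hHs, Matrix.mul_assoc]
  · rw [Matrix.mul_assoc, hGd, hH, cancel]; exact symm _

/-- The Moore-Penrose pseudo-inverse `B⁺`. -/
def pinv [DecidableEq n] (B : Matrix m n ℝ) : Matrix n m ℝ := (exists_isPinv B).choose

theorem pinv_spec [DecidableEq n] (B : Matrix m n ℝ) : IsPinv B (pinv B) :=
  (exists_isPinv B).choose_spec

end Pinv

/-! ### The minimum-norm least-squares estimator -/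

section MinNorm

variable {m n : Type*} [Fintype m] [Fintype n]

/-- The Euclidean norm on `ℝ^ι`. -/
def l2norm {ι : Type*} [Fintype ι] (v : ι → ℝ) : ℝ := ‖WithLp.toLp 2 v‖

theorem l2norm_sq {ι : Type*} [Fintype ι] (v : ι → ℝ) : l2norm v ^ 2 = v ⬝ᵥ v := by
  rw [l2norm, EuclideanSpace.real_norm_sq_eq]
  simp [dotProduct, sq]

theorem dotProduct_self_nonneg {ι : Type*} [Fintype ι] (v : ι → ℝ) : 0 ≤ v ⬝ᵥ v :=
  l2norm_sq v ▸ sq_nonneg _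

theorem l2norm_le_iff {ι κ : Type*} [Fintype ι] [Fintype κ] (v : ι → ℝ) (w : κ → ℝ) :
    l2norm v ≤ l2norm w ↔ v ⬝ᵥ v ≤ w ⬝ᵥ w := by
  rw [← l2norm_sq, ← l2norm_sq]
  exact (pow_le_pow_iff_left₀ (norm_nonneg _) (norm_nonneg _) two_ne_zero).symm

/-- `α` minimises `‖X u - y‖` over all `u`. -/
def IsLeastSquares (X : Matrix m n ℝ) (y : m → ℝ) (α : n → ℝ) : Prop :=
  ∀ u : n → ℝ, l2norm (X *ᵥ α - y) ≤ l2norm (X *ᵥ u - y)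

/-- `α` has the smallest norm among all minimisers of `‖X u - y‖`. -/
def IsMinNormLS (X : Matrix m n ℝ) (y : m → ℝ) (α : n → ℝ) : Prop :=
  IsLeastSquares X y α ∧ ∀ u : n → ℝ, IsLeastSquares X y u → l2norm α ≤ l2norm u

theorem existsUnique_isMinNormLS [DecidableEq n] (X : Matrix m n ℝ) (y : m → ℝ) :
    ∃! α, IsMinNormLS X y α := by
  set P := pinv X with hPdef
  have hP : IsPinv X P := pinv_spec X
  set a := P *ᵥ y with ha
  have orth : ∀ w, (X *ᵥ w) ⬝ᵥ (X *ᵥ a - y) = 0 := by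
    intro w
    have h1 : X *ᵥ w = (X * P) *ᵥ (X *ᵥ w) := by
      rw [Matrix.mulVec_mulVec, hP.mul_mul]
    have h2 : (X * P) *ᵥ (X *ᵥ a - y) = 0 := by
      have h3 : X * P * X * P = X * P := by rw [hP.mul_mul]
      simp only [Matrix.mulVec_sub, ha, Matrix.mulVec_mulVec, ← Matrix.mul_assoc, h3, sub_self]
    calc (X *ᵥ w) ⬝ᵥ (X *ᵥ a - y) = ((X * P)ᵀ *ᵥ (X *ᵥ w)) ⬝ᵥ (X *ᵥ a - y) := by
          rw [hP.symm.eq, ← h1]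
      _ = 0 := by
          rw [Matrix.mulVec_transpose, ← Matrix.dotProduct_mulVec, h2, dotProduct_zero]
  have pyth : ∀ u, (X *ᵥ u - y) ⬝ᵥ (X *ᵥ u - y) =
      (X *ᵥ (u - a)) ⬝ᵥ (X *ᵥ (u - a)) + (X *ᵥ a - y) ⬝ᵥ (X *ᵥ a - y) := by
    intro u
    have : X *ᵥ u - y = X *ᵥ (u - a) + (X *ᵥ a - y) := by
      rw [Matrix.mulVec_sub]; abel
    rw [this, add_dotProduct, dotProduct_add, dotProduct_add, orth,
      dotProduct_comm (X *ᵥ a - y) (X *ᵥ (u - a)), orth]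
    ring
  have aLS : IsLeastSquares X y a := by
    intro u
    rw [l2norm_le_iff, pyth u]
    have := dotProduct_self_nonneg (X *ᵥ (u - a))
    linarith
  have ker : ∀ u, IsLeastSquares X y u → X *ᵥ (u - a) = 0 := by
    intro u hu
    have h := hu a
    rw [l2norm_le_iff, pyth u] at h
    have h0 := dotProduct_self_nonneg (X *ᵥ (u - a))
    exact dotProduct_self_eq_zero.1 (by linarith)
  have pyth2 : ∀ u, IsLeastSquares X y u →
      u ⬝ᵥ u = a ⬝ᵥ a + (u - a) ⬝ᵥ (u - a) := by
    intro u hu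
    have h1 : a = (P * X) *ᵥ a := by
      rw [ha, Matrix.mulVec_mulVec, hP.mul_mul']
    have h2 : a ⬝ᵥ (u - a) = 0 := by
      calc a ⬝ᵥ (u - a) = ((P * X)ᵀ *ᵥ a) ⬝ᵥ (u - a) := by rw [hP.symm'.eq, ← h1]
        _ = 0 := by
          rw [Matrix.mulVec_transpose, ← Matrix.dotProduct_mulVec, ← Matrix.mulVec_mulVec,
            ker u hu, Matrix.mulVec_zero, dotProduct_zero]
    have h3 : u = a + (u - a) := by abel
    conv_lhs => rw [h3]
    rw [add_dotProduct, dotProduct_add, dotProduct_add, h2, dotProduct_comm (u - a) a, h2]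
    ring
  refine ⟨a, ⟨aLS, fun u hu => ?_⟩, fun u hu => ?_⟩
  · rw [l2norm_le_iff, pyth2 u hu]
    have := dotProduct_self_nonneg (u - a)
    linarith
  · have h := hu.2 a aLS
    rw [l2norm_le_iff, pyth2 u hu.1] at h
    have h0 := dotProduct_self_nonneg (u - a)
    exact sub_eq_zero.1 (dotProduct_self_eq_zero.1 (by linarith))

/-- The minimum-norm least-squares estimator
`argmin {‖α‖ : ‖X α - y‖ = min_u ‖X u - y‖}`. -/
def minNormLS [DecidableEq n] (X : Matrix m n ℝ) (y : m → ℝ) : n → ℝ :=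
  (existsUnique_isMinNormLS X y).choose

theorem minNormLS_spec [DecidableEq n] (X : Matrix m n ℝ) (y : m → ℝ) :
    IsMinNormLS X y (minNormLS X y) :=
  (existsUnique_isMinNormLS X y).choose_spec.1

end MinNorm

/-! ### Covariances and sub-Gaussian norms -/

section Prob

variable {Ω : Type*} [MeasurableSpace Ω]

/-- The covariance matrix of a random vector (with square-integrable entries). -/
def covMatrix {ι : Type*} (P : Measure Ω) (W : Ω → ι → ℝ) : Matrix ι ι ℝ :=
  Matrix.of fun i j => cov[fun ω => W ω i, fun ω => W ω j; P]

/-- The sub-Gaussian norm `inf {t > 0 : 𝔼 exp (U² / t²) ≤ 2}` of a real random variable,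
with value `∞` if there is no such `t`. -/
def psi2Norm (P : Measure Ω) (U : Ω → ℝ) : ℝ≥0∞ :=
  ⨅ (t : ℝ) (_ : 0 < t) (_ : ∫⁻ ω, ENNReal.ofReal (Real.exp (U ω ^ 2 / t ^ 2)) ∂P ≤ 2),
    ENNReal.ofReal t

/-- The sub-Gaussian norm of a random vector: the supremum of the sub-Gaussian norms of its
one-dimensional projections onto unit vectors. -/
def psi2NormVec {ι : Type*} [Fintype ι] (P : Measure Ω) (W : Ω → ι → ℝ) : ℝ≥0∞ :=
  ⨆ (v : ι → ℝ) (_ : l2norm v = 1), psi2Norm P (fun ω => v ⬝ᵥ W ω)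

end Prob

/-! ### The factor regression model -/

/-- The factor regression model `X = A Z + E`, `y = Zᵀ β + ε` with `K` factors and `p` features,
observed on a training sample of size `n`. The index `some i` stands for the `i`-th training
observation and `none` for the new observation at which the response is to be predicted. -/
structure Model {Ω : Type*} [MeasurableSpace Ω] (P : Measure Ω) (n p K : ℕ) where
  /-- the loading matrix -/
  A : Matrix (Fin p) (Fin K) ℝ
  /-- the latent regression vector -/
  β : Fin K → ℝ
  /-- the latent factors -/
  Z : Option (Fin n) → Ω → Fin K → ℝ
  /-- the feature noise -/
  E : Option (Fin n) → Ω → Fin p → ℝ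
  /-- the response noise -/
  ε : Option (Fin n) → Ω → ℝ
  measurable_Z : ∀ i, Measurable (Z i)
  measurable_E : ∀ i, Measurable (E i)
  measurable_ε : ∀ i, Measurable (ε i)
  /-- second moments are finite, so that `Σ_Z`, `Σ_E` and `σ_ε²` make sense -/
  memLp_Z : MemLp (Z none) 2 P
  memLp_E : MemLp (E none) 2 P
  memLp_ε : MemLp (ε none) 2 P
  mean_Z : ∀ k, ∫ ω, Z none ω k ∂P = 0
  mean_E : ∀ j, ∫ ω, E none ω j ∂P = 0
  mean_ε : ∫ ω, ε none ω ∂P = 0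
  /-- `Z`, `E` and `ε` are independent -/
  indep_E_ε : IndepFun (E none) (ε none) P
  indep_Z : IndepFun (Z none) (fun ω => (E none ω, ε none ω)) P
  /-- the observations are independent ... -/
  iIndep : iIndepFun (fun i ω => (Z i ω, E i ω, ε i ω)) P
  /-- ... and identically distributed -/
  identDistrib : ∀ i, IdentDistrib (fun ω => (Z i ω, E i ω, ε i ω))
    (fun ω => (Z none ω, E none ω, ε none ω)) P P

namespace Model

variable {Ω : Type*} [MeasurableSpace Ω] {P : Measure Ω} {n p K : ℕ} (M : Model P n p K)

/-- The features `X = A Z + E` of an observation. -/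
def X (i : Option (Fin n)) (ω : Ω) : Fin p → ℝ := M.A *ᵥ M.Z i ω + M.E i ω

/-- The response `y = Zᵀ β + ε` of an observation. -/
def y (i : Option (Fin n)) (ω : Ω) : ℝ := M.Z i ω ⬝ᵥ M.β + M.ε i ω

/-- The covariance matrix `Σ_Z` of the factors. -/
def covZ : Matrix (Fin K) (Fin K) ℝ := covMatrix P (M.Z none)

/-- The covariance matrix `Σ_E` of the feature noise. -/
def covE : Matrix (Fin p) (Fin p) ℝ := covMatrix P (M.E none)

/-- The variance `σ_ε²` of the response noise. -/
def noiseVar : ℝ := Var[M.ε none; P]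

/-- The `n × p` data matrix with rows `X₁, …, X_n`. -/
def dataX (ω : Ω) : Matrix (Fin n) (Fin p) ℝ := Matrix.of fun i => M.X (some i) ω

/-- The `n × K` factor matrix with rows `Z₁, …, Z_n`. -/
def dataZ (ω : Ω) : Matrix (Fin n) (Fin K) ℝ := Matrix.of fun i => M.Z (some i) ω

/-- The response vector `(y₁, …, y_n)`. -/
def dataY (ω : Ω) : Fin n → ℝ := fun i => M.y (some i) ω

/-- The noise vector `(ε₁, …, ε_n)`. -/
def dataε (ω : Ω) : Fin n → ℝ := fun i => M.ε (some i) ω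

/-- The minimum-norm estimator computed from the training data `(X₁, y₁), …, (X_n, y_n)`. -/
def αHat (ω : Ω) : Fin p → ℝ := minNormLS (M.dataX ω) (M.dataY ω)

/-- The oracle least-squares coefficients, the pseudo-inverse of the factor matrix applied to
the response vector. -/
def βHat (ω : Ω) : Fin K → ℝ := pinv (M.dataZ ω) *ᵥ M.dataY ω

/-- The prediction risk `R(α) = 𝔼_{(X,y)} (Xᵀ α - y)²` at a new observation. -/
def risk (α : Fin p → ℝ) : ℝ := ∫ ω, (M.X none ω ⬝ᵥ α - M.y none ω) ^ 2 ∂P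

/-- The risk of the minimum-norm estimator as a function of the outcome `ω`, which determines
the training features and factors, and of an outcome `ω'`, which determines the training noise
`ε₁, …, ε_n`. On the diagonal this is the risk of `αHat`. -/
def riskResampled (ω ω' : Ω) : ℝ :=
  M.risk (minNormLS (M.dataX ω) (M.dataZ ω *ᵥ M.β + M.dataε ω'))

theorem riskResampled_self (ω : Ω) : M.riskResampled ω ω = M.risk (M.αHat ω) := rfl

/-- The expected risk `𝔼_ε R(αHat)`: only the training noise `ε₁, …, ε_n` is averaged, while the
training features and factors stay fixed. -/
def noiseMeanRisk (ω : Ω) : ℝ := ∫ ω', M.riskResampled ω ω' ∂P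

/-- `A` and `Σ_Z` both have full rank `K`. -/
def FullRank : Prop := M.A.rank = K ∧ M.covZ.rank = K

/-- `Z = Σ_Z^{1/2} Z̃` and `ε = σ_ε ε̃`, where `Z̃` and `ε̃` have mean zero and sub-Gaussian
norm at most `L`. Here `S` is the positive semidefinite square root of `Σ_Z`. -/
def IsSubGaussian (L : ℝ) : Prop :=
  (∃ (S : Matrix (Fin K) (Fin K) ℝ) (Zt : Ω → Fin K → ℝ),
    S.PosSemidef ∧ S * S = M.covZ ∧ Measurable Zt ∧
    (∀ᵐ ω ∂P, M.Z none ω = S *ᵥ Zt ω) ∧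
    (∀ k, ∫ ω, Zt ω k ∂P = 0) ∧ psi2NormVec P Zt ≤ ENNReal.ofReal L) ∧
  ∃ εt : Ω → ℝ, Measurable εt ∧
    (∀ᵐ ω ∂P, M.ε none ω = √M.noiseVar * εt ω) ∧
    ∫ ω, εt ω ∂P = 0 ∧ psi2Norm P εt ≤ ENNReal.ofReal L

end Model

end FactorRegression

end

namespace FactorRegression

/-! With no feature noise, least squares on `𝐗 = 𝐙 Aᵀ` solves least squares on `𝐙`, so the excess
risk is `‖V⁺ ε‖²`, where `V` is the whitened factor matrix. A union bound over a net of the sphere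
with Chernoff bounds for the marginals puts the squared singular values of `V` at order `n`. Every
row of `V⁺` then has squared length of order `1 / n`: the sub-Gaussian tail of the noise, which is
independent of `V`, gives `σ_ε² log n / n` for each coordinate of `V⁺ ε`, while its mean square
is at least of order `σ_ε² / n`. -/

/-! ### Nets -/

section Net

open Metric Module
open scoped NNReal

theorem packingNumber_ne_top_of_totallyBounded {X : Type*} [PseudoEMetricSpace X] {s : Set X}
    (hs : TotallyBounded s) {δ : ℝ≥0} (hδ : δ ≠ 0) : packingNumber δ s ≠ ⊤ := by
  obtain ⟨t, -, ht, hcover⟩ := exists_finite_isCover_of_totallyBounded (half_pos hδ.bot_lt).ne' hs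
  have hle : packingNumber (2 * (δ / 2)) s ≤ t.encard :=
    (packingNumber_two_mul_le_externalCoveringNumber _ _).trans
      hcover.externalCoveringNumber_le_encard
  rw [mul_div_cancel₀ δ two_ne_zero] at hle
  exact ne_top_of_le_ne_top ht.encard_lt_top.ne hle

variable {F : Type*} [NormedAddCommGroup F] [NormedSpace ℝ F] {δ : ℝ≥0}

section FiniteDimensional

variable [FiniteDimensional ℝ F]

theorem card_le_of_isSeparated (hδ : δ ≠ 0) {x : F} {R : ℝ} (hR : 0 ≤ R) {s : Finset F}
    (hs : (s : Set F) ⊆ closedBall x R) (hsep : IsSeparated δ (s : Set F)) :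
    (s.card : ℝ) ≤ (2 * R / δ + 1) ^ finrank ℝ F := by
  borelize F
  let μ : Measure F := Measure.addHaar
  have hδ0 : (0 : ℝ) < δ := NNReal.coe_pos.2 hδ.bot_lt
  have hδ2 : (0 : ℝ) < δ / 2 := half_pos hδ0
  have hR2 : 0 < R + δ / 2 := by positivity
  have hdisj : (s : Set F).Pairwise (Function.onFun Disjoint fun c => ball c (δ / 2)) := by
    intro c hc d hd hcd
    refine ball_disjoint_ball ?_
    have hlt : (δ : ℝ≥0∞) < edist c d := hsep hc hd hcd
    rw [edist_nndist, ENNReal.coe_lt_coe, ← NNReal.coe_lt_coe, coe_nndist] at hlt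
    linarith
  have hsub : (⋃ c ∈ s, ball c (δ / 2)) ⊆ ball x (R + δ / 2) := by
    refine Set.iUnion₂_subset fun c hc => ball_subset_ball' ?_
    linarith [mem_closedBall.1 (hs hc)]
  have hvol : (s.card : ℝ≥0∞) * ENNReal.ofReal ((δ / 2) ^ finrank ℝ F) * μ (ball 0 1) ≤
      ENNReal.ofReal ((R + δ / 2) ^ finrank ℝ F) * μ (ball 0 1) :=
    calc (s.card : ℝ≥0∞) * ENNReal.ofReal ((δ / 2) ^ finrank ℝ F) * μ (ball 0 1)
        = μ (⋃ c ∈ s, ball c (δ / 2)) := by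
          rw [measure_biUnion_finset hdisj fun c _ => measurableSet_ball]
          simp only [μ.addHaar_ball_of_pos _ hδ2, Finset.sum_const, nsmul_eq_mul, mul_assoc]
      _ ≤ μ (ball x (R + δ / 2)) := measure_mono hsub
      _ = _ := by rw [μ.addHaar_ball_of_pos _ hR2]
  have hcard := ENNReal.toReal_le_of_le_ofReal (by positivity)
    ((ENNReal.mul_le_mul_iff_left (measure_ball_pos μ _ zero_lt_one).ne'
      measure_ball_lt_top.ne).1 hvol)
  rw [ENNReal.toReal_mul, ENNReal.toReal_natCast, ENNReal.toReal_ofReal (by positivity),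
    ← le_div_iff₀ (by positivity), ← div_pow] at hcard
  have hratio : (R + δ / 2) / (δ / 2) = 2 * R / δ + 1 := by field_simp
  rwa [hratio] at hcard

theorem exists_finset_isCover_card_le (hδ : δ ≠ 0) {x : F} {R : ℝ} (hR : 0 ≤ R) {s : Set F}
    (hs : s ⊆ closedBall x R) :
    ∃ t : Finset F, (t.card : ℝ) ≤ (2 * R / δ + 1) ^ finrank ℝ F ∧ (t : Set F) ⊆ s ∧
      IsCover δ s (t : Set F) := by
  have hpack : packingNumber δ s ≠ ⊤ :=
    packingNumber_ne_top_of_totallyBounded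
      ((isCompact_closedBall x R).totallyBounded.subset hs) hδ
  have hfin : (maximalSeparatedSet δ s).Finite := by
    rw [← Set.encard_ne_top_iff, encard_maximalSeparatedSet hpack]
    exact hpack
  refine ⟨hfin.toFinset, card_le_of_isSeparated hδ (x := x) hR ?_ ?_, ?_, ?_⟩ <;>
    rw [hfin.coe_toFinset]
  · exact maximalSeparatedSet_subset.trans hs
  · exact isSeparated_maximalSeparatedSet
  · exact maximalSeparatedSet_subset
  · exact isCover_maximalSeparatedSet hpack

end FiniteDimensional

variable {G : Type*} [NormedAddCommGroup G] [NormedSpace ℝ G] (T : F →L[ℝ] G) {s : Set F} {m : ℝ}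

theorem one_sub_mul_opNorm_le_of_isCover_sphere (hs : IsCover δ (sphere (0 : F) 1) s) (hm : 0 ≤ m)
    (h : ∀ u ∈ s, ‖T u‖ ≤ m) : (1 - δ) * ‖T‖ ≤ m := by
  suffices ‖T‖ ≤ m + ‖T‖ * δ by linarith
  refine T.opNorm_le_of_unit_norm (by positivity) fun v hv => ?_
  obtain ⟨u, hu, hvu⟩ := Set.mem_iUnion₂.1 (isCover_iff_subset_iUnion_closedBall.1 hs
    (mem_sphere_zero_iff_norm.2 hv))
  rw [mem_closedBall_iff_norm] at hvu
  calc ‖T v‖ = ‖T u + T (v - u)‖ := by rw [← map_add, add_sub_cancel]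
    _ ≤ ‖T u‖ + ‖T (v - u)‖ := norm_add_le _ _
    _ ≤ m + ‖T‖ * δ := add_le_add (h u hu) (T.le_opNorm_of_le hvu)

theorem sub_mul_norm_le_of_isCover_sphere (hs : IsCover δ (sphere (0 : F) 1) s)
    (h : ∀ u ∈ s, m ≤ ‖T u‖) (v : F) : (m - ‖T‖ * δ) * ‖v‖ ≤ ‖T v‖ := by
  obtain rfl | hv := eq_or_ne v 0
  · simp
  have unit : ∀ w : F, ‖w‖ = 1 → m - ‖T‖ * δ ≤ ‖T w‖ := by
    intro w hw
    obtain ⟨u, hu, hwu⟩ := Set.mem_iUnion₂.1 (isCover_iff_subset_iUnion_closedBall.1 hs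
      (mem_sphere_zero_iff_norm.2 hw))
    rw [mem_closedBall_iff_norm] at hwu
    have htri : ‖T u‖ ≤ ‖T w‖ + ‖T (w - u)‖ := by
      rw [map_sub]
      exact norm_le_norm_add_norm_sub _ _
    linarith [h u hu, T.le_opNorm_of_le hwu]
  have hunit := unit (‖v‖⁻¹ • v) (by simp [norm_smul, hv])
  rwa [map_smul, norm_smul, norm_inv, norm_norm, inv_mul_eq_div,
    le_div_iff₀ (norm_pos_iff.2 hv)] at hunit

end Net

/-! ### Full-rank designs -/

section LeastSquares

variable {m n : Type*} [Fintype m] [Fintype n]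

omit [Fintype m] in
theorem rank_eq_card_iff_mulVec_injective {R : Type*} [Field R] {B : Matrix m n R} :
    B.rank = Fintype.card n ↔ Function.Injective B.mulVec := by
  rw [Matrix.mulVec_injective_iff, linearIndependent_iff_card_eq_finrank_span, Matrix.rank,
    Matrix.range_mulVecLin, eq_comm]
  rfl

variable {B : Matrix m n ℝ} {a b : ℝ}

theorem mulVec_injective_of_le (ha : 0 < a) (h : ∀ v, a * (v ⬝ᵥ v) ≤ (B *ᵥ v) ⬝ᵥ (B *ᵥ v)) :
    Function.Injective B.mulVec := by
  rw [← Matrix.coe_mulVecLin, injective_iff_map_eq_zero]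
  intro v hv
  have hv' := h v
  rw [← Matrix.mulVecLin_apply, hv, dotProduct_zero] at hv'
  exact dotProduct_self_eq_zero.1
    (le_antisymm (nonpos_of_mul_nonpos_right hv' ha) (dotProduct_self_nonneg v))

/-- The squared singular values of `B` lie between `a` and `b`; this is `a • 1 ≤ Bᵀ B ≤ b • 1`
written as quadratic forms. -/
structure GramBounds (B : Matrix m n ℝ) (a b : ℝ) : Prop where
  lower : ∀ v, a * (v ⬝ᵥ v) ≤ (B *ᵥ v) ⬝ᵥ (B *ᵥ v)
  upper : ∀ v, (B *ᵥ v) ⬝ᵥ (B *ᵥ v) ≤ b * (v ⬝ᵥ v)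

theorem gramBounds_of_isCover_sphere {δ : NNReal} {s : Set (EuclideanSpace ℝ n)}
    (hs : Metric.IsCover δ (Metric.sphere 0 1) s) {lo hi : ℝ} (hδ : (δ : ℝ) ≤ 1 / 2)
    (hhi : 0 ≤ hi) (hlo : 2 * hi * δ ≤ lo)
    (hle : ∀ u ∈ s, l2norm (B *ᵥ u.ofLp) ≤ hi) (hge : ∀ u ∈ s, lo ≤ l2norm (B *ᵥ u.ofLp)) :
    GramBounds B ((lo - 2 * hi * δ) ^ 2) ((2 * hi) ^ 2) := by
  classical
  let T : EuclideanSpace ℝ n →L[ℝ] EuclideanSpace ℝ m :=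
    (Matrix.toEuclideanLin B).toContinuousLinearMap
  have hT : ‖T‖ ≤ 2 * hi := by
    nlinarith [norm_nonneg T, one_sub_mul_opNorm_le_of_isCover_sphere T hs hhi hle]
  refine ⟨fun v => ?_, fun v => ?_⟩ <;> rw [← l2norm_sq, ← l2norm_sq, ← mul_pow]
  · have hlow : (lo - ‖T‖ * δ) * l2norm v ≤ l2norm (B *ᵥ v) :=
      sub_mul_norm_le_of_isCover_sphere T hs hge (WithLp.toLp 2 v)
    have hv : 0 ≤ l2norm v := norm_nonneg _
    refine pow_le_pow_left₀ (mul_nonneg (by linarith) hv) (le_trans ?_ hlow) 2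
    gcongr
  · exact pow_le_pow_left₀ (norm_nonneg _) (T.le_of_opNorm_le hT (WithLp.toLp 2 v)) 2

variable [DecidableEq n]

/-- The left inverse `(Bᵀ B)⁻¹ Bᵀ` of a matrix with linearly independent columns, which sends `y`
to the least-squares coefficients of `y` on the columns of `B`. -/
noncomputable def leftInv (B : Matrix m n ℝ) : Matrix n m ℝ := (Bᵀ * B)⁻¹ * Bᵀ

theorem isUnit_det_transpose_mul_self (hB : Function.Injective B.mulVec) :
    IsUnit (Bᵀ * B).det := by
  rw [← Matrix.isUnit_iff_isUnit_det, ← Matrix.mulVec_injective_iff_isUnit,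
    ← rank_eq_card_iff_mulVec_injective, Matrix.rank_transpose_mul_self,
    rank_eq_card_iff_mulVec_injective]
  exact hB

theorem transpose_mul_self_mul_leftInv (hB : Function.Injective B.mulVec) :
    Bᵀ * B * leftInv B = Bᵀ := by
  rw [leftInv, Matrix.mul_nonsing_inv_cancel_left _ _ (isUnit_det_transpose_mul_self hB)]

theorem leftInv_mul (hB : Function.Injective B.mulVec) : leftInv B * B = 1 := by
  rw [leftInv, Matrix.mul_assoc, Matrix.nonsing_inv_mul _ (isUnit_det_transpose_mul_self hB)]

theorem pinv_eq_leftInv (hB : Function.Injective B.mulVec) : pinv B = leftInv B := by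
  refine (pinv_spec B).unique ⟨?_, ?_, ?_, ?_⟩
  · rw [Matrix.mul_assoc, leftInv_mul hB, Matrix.mul_one]
  · rw [leftInv_mul hB, Matrix.one_mul]
  · rw [leftInv, ← Matrix.mul_assoc, Matrix.IsSymm, Matrix.transpose_mul, Matrix.transpose_mul,
      Matrix.transpose_nonsing_inv, Matrix.transpose_mul, Matrix.transpose_transpose,
      Matrix.mul_assoc]
  · rw [leftInv_mul hB]
    exact Matrix.isSymm_one

theorem IsLeastSquares.eq_leftInv_mulVec (hB : Function.Injective B.mulVec) {v : n → ℝ}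
    {y : m → ℝ} (h : IsLeastSquares B y v) : v = leftInv B *ᵥ y := by
  set a := leftInv B *ᵥ y
  have horth : (B *ᵥ (v - a)) ⬝ᵥ (B *ᵥ a - y) = 0 := by
    rw [dotProduct_comm, ← Matrix.dotProduct_transpose_mulVec, Matrix.mulVec_sub,
      Matrix.mulVec_mulVec, Matrix.mulVec_mulVec, transpose_mul_self_mul_leftInv hB, sub_self,
      dotProduct_zero]
  have hsplit : B *ᵥ v - y = B *ᵥ (v - a) + (B *ᵥ a - y) := by
    rw [Matrix.mulVec_sub, sub_add_sub_cancel]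
  have hle := (l2norm_le_iff _ _).1 (h a)
  rw [hsplit, add_dotProduct, dotProduct_add, dotProduct_add, dotProduct_comm (B *ᵥ a - y),
    horth] at hle
  have hzero : B *ᵥ (v - a) = 0 := dotProduct_self_eq_zero.1
    (le_antisymm (by linarith) (dotProduct_self_nonneg _))
  exact sub_eq_zero.1 (hB (hzero.trans (Matrix.mulVec_zero B).symm))

omit [DecidableEq n] in
theorem IsLeastSquares.of_mul_transpose {q : Type*} [Fintype q] {A : Matrix q n ℝ}
    (hA : Function.Injective A.mulVec) {y : m → ℝ} {α : q → ℝ}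
    (h : IsLeastSquares (B * Aᵀ) y α) : IsLeastSquares B y (Aᵀ *ᵥ α) := by
  classical
  intro u
  have hinv : Aᵀ *ᵥ ((leftInv A)ᵀ *ᵥ u) = u := by
    rw [Matrix.mulVec_mulVec, ← Matrix.transpose_mul, leftInv_mul hA, Matrix.transpose_one,
      Matrix.one_mulVec]
  simpa only [← Matrix.mulVec_mulVec, hinv] using h ((leftInv A)ᵀ *ᵥ u)

theorem mul_leftInv_mulVec_le (ha : 0 < a) (h : ∀ v, a * (v ⬝ᵥ v) ≤ (B *ᵥ v) ⬝ᵥ (B *ᵥ v))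
    (e : m → ℝ) : a * ((leftInv B *ᵥ e) ⬝ᵥ (leftInv B *ᵥ e)) ≤ e ⬝ᵥ e := by
  set w := leftInv B *ᵥ e with hw
  have hnormal : Bᵀ *ᵥ (B *ᵥ w) = Bᵀ *ᵥ e := by
    rw [Matrix.mulVec_mulVec, hw, Matrix.mulVec_mulVec,
      transpose_mul_self_mul_leftInv (mulVec_injective_of_le ha h)]
  have hproj : (B *ᵥ w) ⬝ᵥ (B *ᵥ w) = e ⬝ᵥ (B *ᵥ w) := by
    rw [← Matrix.dotProduct_transpose_mulVec, hnormal, Matrix.dotProduct_transpose_mulVec]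
  have hres := dotProduct_self_nonneg (e - B *ᵥ w)
  rw [sub_dotProduct, dotProduct_sub, dotProduct_sub, dotProduct_comm (B *ᵥ w) e] at hres
  linarith [h w]

theorem leftInv_row_le (ha : 0 < a) (h : ∀ v, a * (v ⬝ᵥ v) ≤ (B *ᵥ v) ⬝ᵥ (B *ᵥ v)) (k : n) :
    leftInv B k ⬝ᵥ leftInv B k ≤ 1 / a := by
  set q := leftInv B k ⬝ᵥ leftInv B k
  have hq0 : 0 ≤ q := dotProduct_self_nonneg _
  have hcoord : q ^ 2 ≤ (leftInv B *ᵥ leftInv B k) ⬝ᵥ (leftInv B *ᵥ leftInv B k) := by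
    rw [sq]
    exact Finset.single_le_sum (f := fun i => (leftInv B *ᵥ leftInv B k) i *
      (leftInv B *ᵥ leftInv B k) i) (fun i _ => mul_self_nonneg _) (Finset.mem_univ k)
  have hsq : a * q ^ 2 ≤ q :=
    (mul_le_mul_of_nonneg_left hcoord ha.le).trans (mul_leftInv_mulVec_le ha h _)
  rw [le_div_iff₀ ha]
  obtain hq' | hq' := hq0.eq_or_lt
  · simp [← hq']
  · nlinarith

theorem le_leftInv_row (hb : 0 < b) (hB : Function.Injective B.mulVec)
    (h : ∀ v, (B *ᵥ v) ⬝ᵥ (B *ᵥ v) ≤ b * (v ⬝ᵥ v)) (k : n) :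
    1 / b ≤ leftInv B k ⬝ᵥ leftInv B k := by
  have hdual : leftInv B k ⬝ᵥ B.col k = 1 := by
    simpa [Matrix.mul_apply, dotProduct] using congrFun₂ (leftInv_mul hB) k k
  have hcol : B.col k ⬝ᵥ B.col k ≤ b := by
    simpa using h (Pi.single k 1)
  have hcauchy : (leftInv B k ⬝ᵥ B.col k) ^ 2 ≤
      (leftInv B k ⬝ᵥ leftInv B k) * (B.col k ⬝ᵥ B.col k) := by
    simpa only [dotProduct, sq] using
      Finset.sum_mul_sq_le_sq_mul_sq Finset.univ (leftInv B k) (B.col k)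
  rw [div_le_iff₀ hb]
  calc 1 = (leftInv B k ⬝ᵥ B.col k) ^ 2 := by rw [hdual, one_pow]
    _ ≤ _ := hcauchy
    _ ≤ _ := mul_le_mul_of_nonneg_left hcol (dotProduct_self_nonneg _)

end LeastSquares

/-! ### Tails -/

section Tail

variable {Ω : Type*} [MeasurableSpace Ω] {P : Measure Ω} {U : Ω → ℝ} {T : ℝ}

/-- The bound `‖U‖_ψ₂ ≤ T` in the form of the exponential moment `𝔼 exp (U² / T²) ≤ 2`, with a
Bochner integral. -/
structure HasPsi2Bound (P : Measure Ω) (U : Ω → ℝ) (T : ℝ) : Prop where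
  integrable : Integrable (fun ω => Real.exp (U ω ^ 2 / T ^ 2)) P
  integral_le : ∫ ω, Real.exp (U ω ^ 2 / T ^ 2) ∂P ≤ 2

theorem hasPsi2Bound_of_psi2Norm_lt (hU : Measurable U) (h : psi2Norm P U < ENNReal.ofReal T) :
    HasPsi2Bound P U T := by
  have hT : 0 < T := ENNReal.ofReal_pos.1 (pos_of_gt h)
  simp only [psi2Norm, iInf_lt_iff] at h
  obtain ⟨t, ht, hmoment, htT⟩ := h
  have htT' : t < T := (ENNReal.ofReal_lt_ofReal_iff hT).1 htT
  have hle : ∫⁻ ω, ENNReal.ofReal (Real.exp (U ω ^ 2 / T ^ 2)) ∂P ≤ 2 := by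
    refine (lintegral_mono fun ω => ?_).trans hmoment
    gcongr
  have hpos : 0 ≤ᵐ[P] fun ω => Real.exp (U ω ^ 2 / T ^ 2) :=
    Filter.Eventually.of_forall fun ω => (Real.exp_pos _).le
  have hmeas : AEStronglyMeasurable (fun ω => Real.exp (U ω ^ 2 / T ^ 2)) P := by fun_prop
  refine ⟨⟨hmeas, ?_⟩, ?_⟩
  · rw [hasFiniteIntegral_iff_ofReal hpos]
    exact hle.trans_lt ENNReal.ofNat_lt_top
  · rw [integral_eq_lintegral_of_nonneg_ae hpos hmeas]
    exact ENNReal.toReal_le_of_le_ofReal zero_le_two (by simpa using hle)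

theorem exp_neg_le_one_sub_add_sq_div_two {x : ℝ} (hx : 0 ≤ x) :
    Real.exp (-x) ≤ 1 - x + x ^ 2 / 2 := by
  have hquad := Real.quadratic_le_exp_of_nonneg hx
  have hpos : 0 < 1 - x + x ^ 2 / 2 := by nlinarith [sq_nonneg (x - 1)]
  rw [Real.exp_neg, inv_le_comm₀ (Real.exp_pos _) hpos]
  refine le_trans ?_ hquad
  rw [inv_le_iff_one_le_mul₀ hpos]
  nlinarith [sq_nonneg (x ^ 2)]

theorem exp_le_add_exp_sq (x : ℝ) : Real.exp x ≤ x + Real.exp (x ^ 2) := by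
  have hsq := Real.add_one_le_exp (x ^ 2)
  by_cases h : |x| ≤ 1
  · have hquad := le_of_abs_le (Real.abs_exp_sub_one_sub_id_le h)
    linarith
  · rcases lt_abs.1 (not_le.1 h) with h | h
    · have : Real.exp x ≤ Real.exp (x ^ 2) := Real.exp_le_exp.2 (by nlinarith)
      linarith
    · have : Real.exp x ≤ 1 := Real.exp_le_one_iff.2 (by linarith)
      nlinarith

theorem exp_mul_le_exp_mul_add_div_two (hT : T ≠ 0) (t u : ℝ) :
    Real.exp (t * u) ≤ Real.exp (t ^ 2 * T ^ 2 / 2) * ((1 + Real.exp (u ^ 2 / T ^ 2)) / 2) := by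
  have hyoung : t * u ≤ t ^ 2 * T ^ 2 / 2 + u ^ 2 / T ^ 2 / 2 := by
    have hmul : t * u = (t * T) * (u / T) := by field_simp
    rw [hmul, ← mul_pow, ← div_pow]
    nlinarith [sq_nonneg (t * T - u / T)]
  have hsqrt : Real.exp (u ^ 2 / T ^ 2 / 2) ≤ (1 + Real.exp (u ^ 2 / T ^ 2)) / 2 := by
    have hsq : Real.exp (u ^ 2 / T ^ 2) = Real.exp (u ^ 2 / T ^ 2 / 2) ^ 2 := by
      rw [← Real.exp_nat_mul]
      push_cast
      ring_nf
    rw [hsq]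
    nlinarith [sq_nonneg (Real.exp (u ^ 2 / T ^ 2 / 2) - 1)]
  calc Real.exp (t * u) ≤ Real.exp (t ^ 2 * T ^ 2 / 2 + u ^ 2 / T ^ 2 / 2) :=
        Real.exp_le_exp.2 hyoung
    _ = Real.exp (t ^ 2 * T ^ 2 / 2) * Real.exp (u ^ 2 / T ^ 2 / 2) := Real.exp_add _ _
    _ ≤ _ := by gcongr

theorem exp_mul_le_add_of_sq_mul_sq_le_one (hT : T ≠ 0) {t : ℝ}
    (ht : t ^ 2 * T ^ 2 ≤ 1) (u : ℝ) :
    Real.exp (t * u) ≤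
      t * u + ((1 - t ^ 2 * T ^ 2) + t ^ 2 * T ^ 2 * Real.exp (u ^ 2 / T ^ 2)) := by
  have hconv := convexOn_exp.2 (Set.mem_univ 0) (Set.mem_univ (u ^ 2 / T ^ 2))
    (sub_nonneg.2 ht) (show 0 ≤ t ^ 2 * T ^ 2 by positivity) (sub_add_cancel 1 _)
  have hsq : (1 - t ^ 2 * T ^ 2) • (0 : ℝ) + (t ^ 2 * T ^ 2) • (u ^ 2 / T ^ 2) = (t * u) ^ 2 := by
    simp only [smul_eq_mul]
    field_simp
    ring
  rw [hsq] at hconv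
  calc Real.exp (t * u) ≤ t * u + Real.exp ((t * u) ^ 2) := exp_le_add_exp_sq _
    _ ≤ _ := by gcongr; simpa using hconv

namespace HasPsi2Bound

theorem congr_identDistrib {Ω' : Type*} [MeasurableSpace Ω'] {P' : Measure Ω'} {U' : Ω' → ℝ}
    (h : HasPsi2Bound P U T) (hUU' : IdentDistrib U U' P P') : HasPsi2Bound P' U' T := by
  have hexp := hUU'.comp (u := fun x => Real.exp (x ^ 2 / T ^ 2)) (by fun_prop)
  exact ⟨hexp.integrable_iff.1 h.integrable, hexp.integral_eq ▸ h.integral_le⟩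

theorem integrable_self (hU : Measurable U) (hT : 0 < T) (h : HasPsi2Bound P U T) :
    Integrable U P := by
  refine (h.integrable.const_mul T).mono' hU.aestronglyMeasurable
    (Filter.Eventually.of_forall fun ω => ?_)
  have hexp := Real.add_one_le_exp (U ω ^ 2 / T ^ 2)
  have hsq : |U ω| / T ≤ U ω ^ 2 / T ^ 2 + 1 := by
    rw [← sq_abs, ← div_pow]
    nlinarith [sq_nonneg (|U ω| / T - 1)]
  calc ‖U ω‖ = T * (|U ω| / T) := by rw [Real.norm_eq_abs]; field_simp
    _ ≤ T * Real.exp (U ω ^ 2 / T ^ 2) := by gcongr; exact hsq.trans hexp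

variable [IsProbabilityMeasure P]

theorem integrable_exp_mul (hU : Measurable U) (hT : 0 < T) (h : HasPsi2Bound P U T) (t : ℝ) :
    Integrable (fun ω => Real.exp (t * U ω)) P :=
  ((((integrable_const _).add h.integrable).div_const _).const_mul _).mono' (by fun_prop)
    (Filter.Eventually.of_forall fun ω => by
      rw [Real.norm_eq_abs, Real.abs_exp]
      exact exp_mul_le_exp_mul_add_div_two hT.ne' t (U ω))

theorem mgf_le_of_le_one (hU : Measurable U) (hT : 0 < T) (h : HasPsi2Bound P U T)
    (h0 : ∫ ω, U ω ∂P = 0) {t : ℝ} (ht : t ^ 2 * T ^ 2 ≤ 1) :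
    mgf U P t ≤ Real.exp (t ^ 2 * T ^ 2) := by
  set f : Ω → ℝ := fun ω => Real.exp (U ω ^ 2 / T ^ 2)
  have hf : Integrable f P := h.integrable
  have hUint := h.integrable_self hU hT
  set θ := t ^ 2 * T ^ 2
  calc mgf U P t ≤ ∫ ω, (t * U ω + ((1 - θ) + θ * f ω)) ∂P :=
        integral_mono (h.integrable_exp_mul hU hT t) (by fun_prop)
          fun ω => exp_mul_le_add_of_sq_mul_sq_le_one hT.ne' ht (U ω)
    _ = 1 - θ + θ * ∫ ω, f ω ∂P := by
        rw [integral_add (hUint.const_mul _) (by fun_prop),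
          integral_add (integrable_const _) (hf.const_mul _),
          integral_const_mul, integral_const_mul, h0]
        simp
    _ ≤ 1 - θ + θ * 2 := by gcongr; exact h.integral_le
    _ = θ + 1 := by ring
    _ ≤ Real.exp θ := Real.add_one_le_exp _

theorem mgf_le_of_one_le (hU : Measurable U) (hT : 0 < T) (h : HasPsi2Bound P U T) {t : ℝ}
    (ht : 1 ≤ t ^ 2 * T ^ 2) : mgf U P t ≤ Real.exp (t ^ 2 * T ^ 2) := by
  set f : Ω → ℝ := fun ω => Real.exp (U ω ^ 2 / T ^ 2)
  have hf : Integrable f P := h.integrable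
  set θ := t ^ 2 * T ^ 2
  calc mgf U P t ≤ ∫ ω, Real.exp (θ / 2) * ((1 + f ω) / 2) ∂P :=
        integral_mono (h.integrable_exp_mul hU hT t) (by fun_prop)
          fun ω => exp_mul_le_exp_mul_add_div_two hT.ne' t (U ω)
    _ = Real.exp (θ / 2) * ((1 + ∫ ω, f ω ∂P) / 2) := by
        rw [integral_const_mul, integral_div, integral_add (integrable_const _) hf]
        simp
    _ ≤ Real.exp (θ / 2) * (θ / 2 + 1) := by
        gcongr
        linarith [h.integral_le]
    _ ≤ Real.exp (θ / 2) * Real.exp (θ / 2) := by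
        gcongr
        exact Real.add_one_le_exp _
    _ = Real.exp θ := by rw [← Real.exp_add, add_halves]

theorem hasSubgaussianMGF (hU : Measurable U) (hT : 0 < T) (h : HasPsi2Bound P U T)
    (h0 : ∫ ω, U ω ∂P = 0) : HasSubgaussianMGF U (2 * T.toNNReal ^ 2) P := by
  refine ⟨h.integrable_exp_mul hU hT, fun t => ?_⟩
  have hexponent : ((2 * T.toNNReal ^ 2 : NNReal) : ℝ) * t ^ 2 / 2 = t ^ 2 * T ^ 2 := by
    push_cast
    rw [Real.coe_toNNReal _ hT.le]
    ring
  rw [hexponent]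
  exact (le_total (t ^ 2 * T ^ 2) 1).elim (h.mgf_le_of_le_one hU hT h0) (h.mgf_le_of_one_le hU hT)

theorem mgf_sq_le (hT : 0 < T) (h : HasPsi2Bound P U T) (h1 : ∫ ω, U ω ^ 2 ∂P = 1) :
    mgf (fun ω => U ω ^ 2) P (-(1 / (4 * T ^ 4))) ≤ Real.exp (-(1 / (8 * T ^ 4))) := by
  have hint : Integrable (fun ω => U ω ^ 2) P := .of_integral_ne_zero (h1 ▸ one_ne_zero)
  set s : ℝ := 1 / (4 * T ^ 4) with hs
  have : 0 < s := by positivity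
  have hpt : ∀ ω, Real.exp (-s * U ω ^ 2) ≤
      1 - s * U ω ^ 2 + s ^ 2 * T ^ 4 * Real.exp (U ω ^ 2 / T ^ 2) := by
    intro ω
    have hquad := exp_neg_le_one_sub_add_sq_div_two (x := s * U ω ^ 2) (by positivity)
    have hexp := Real.pow_div_factorial_le_exp (U ω ^ 2 / T ^ 2) (by positivity) 2
    have hfourth : (U ω ^ 2) ^ 2 ≤ 2 * T ^ 4 * Real.exp (U ω ^ 2 / T ^ 2) := by
      calc (U ω ^ 2) ^ 2 = 2 * T ^ 4 * ((U ω ^ 2 / T ^ 2) ^ 2 / (2 : ℕ).factorial) := by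
            norm_num [Nat.factorial]
            field_simp
        _ ≤ _ := by gcongr
    rw [neg_mul]
    nlinarith [sq_nonneg s]
  calc mgf (fun ω => U ω ^ 2) P (-s)
      ≤ ∫ ω, (1 - s * U ω ^ 2 + s ^ 2 * T ^ 4 * Real.exp (U ω ^ 2 / T ^ 2)) ∂P :=
        integral_mono_of_nonneg (Filter.Eventually.of_forall fun ω => (Real.exp_pos _).le)
          (((integrable_const _).sub (hint.const_mul _)).add (h.integrable.const_mul _))
          (Filter.Eventually.of_forall hpt)
    _ = 1 - s + s ^ 2 * T ^ 4 * ∫ ω, Real.exp (U ω ^ 2 / T ^ 2) ∂P := by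
        rw [integral_add (by fun_prop) (h.integrable.const_mul _),
          integral_sub (integrable_const _) (hint.const_mul _),
          integral_const_mul, integral_const_mul, h1]
        simp
    _ ≤ 1 - s + s ^ 2 * T ^ 4 * 2 := by gcongr; exact h.integral_le
    _ = -(1 / (8 * T ^ 4)) + 1 := by rw [hs]; field_simp; ring
    _ ≤ _ := Real.add_one_le_exp _

end HasPsi2Bound

theorem hasSubgaussianMGF_mono {c c' : NNReal} (h : HasSubgaussianMGF U c P) (hc : c ≤ c') :
    HasSubgaussianMGF U c' P :=
  ⟨h.integrable_exp_mul, fun t => (h.mgf_le t).trans (by gcongr)⟩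

theorem measureReal_lt_sq_le [IsProbabilityMeasure P] {c : NNReal} (h : HasSubgaussianMGF U c P)
    {x : ℝ} (hx : 0 ≤ x) : P.real {ω | 2 * c * x < U ω ^ 2} ≤ 2 * Real.exp (-x) := by
  rcases eq_or_ne c 0 with rfl | hc
  · have hnull : P {ω | 2 * ((0 : NNReal) : ℝ) * x < U ω ^ 2} = 0 := by
      refine measure_mono_null ?_ (HasSubgaussianMGF.ae_eq_zero_of_hasSubgaussianMGF_zero h)
      intro ω hω (hzero : U ω = 0)
      simp [hzero] at hω
    rw [Measure.real, hnull, ENNReal.toReal_zero]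
    positivity
  · have : (0 : ℝ) < c := NNReal.coe_pos.2 (pos_iff_ne_zero.2 hc)
    set t := √(2 * c * x)
    have ht : t ^ 2 = 2 * c * x := Real.sq_sqrt (by positivity)
    have ht0 : 0 ≤ t := Real.sqrt_nonneg _
    have hexp : -t ^ 2 / (2 * c) = -x := by rw [ht]; field_simp
    have hupper := h.measure_ge_le ht0
    have hlower := h.neg.measure_ge_le ht0
    rw [hexp] at hupper hlower
    calc P.real {ω | 2 * c * x < U ω ^ 2}
        ≤ P.real ({ω | t ≤ U ω} ∪ {ω | t ≤ (-U) ω}) := by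
          refine measureReal_mono fun ω hω => ?_
          rw [Set.mem_ofPred_eq, ← ht, sq_lt_sq, abs_of_nonneg ht0] at hω
          exact le_abs.1 hω.le
      _ ≤ _ := measureReal_union_le _ _
      _ ≤ _ := by linarith

section Chernoff

variable {ι : Type*} [Fintype ι] {W : ι → Ω → ℝ}

theorem measureReal_le_sum_le_exp (hind : iIndepFun W P)
    (hW : ∀ i, Measurable (W i)) {t a : ℝ} (ht : 0 ≤ t)
    (hint : ∀ i, Integrable (fun ω => Real.exp (t * W i ω)) P)
    (hmgf : ∀ i, mgf (W i) P t ≤ Real.exp a) (x : ℝ) :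
    P.real {ω | x ≤ ∑ i, W i ω} ≤ Real.exp (Fintype.card ι * a - t * x) := by
  have := hind.isProbabilityMeasure
  have hchernoff := measure_ge_le_exp_mul_mgf x ht
    (hind.integrable_exp_mul_sum hW (s := Finset.univ) fun i _ => hint i)
  simp only [Finset.sum_apply] at hchernoff
  calc P.real {ω | x ≤ ∑ i, W i ω} ≤ Real.exp (-t * x) * mgf (∑ i, W i) P t := hchernoff
    _ = Real.exp (-t * x) * ∏ i, mgf (W i) P t := by rw [hind.mgf_sum hW]
    _ ≤ Real.exp (-t * x) * ∏ _i : ι, Real.exp a := by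
        gcongr with i
        · exact fun i _ => mgf_nonneg
        · exact hmgf i
    _ = _ := by
        rw [Finset.prod_const, Finset.card_univ, ← Real.exp_nat_mul, ← Real.exp_add]
        ring_nf

end Chernoff

section SumSq

variable {ι : Type*} [Fintype ι] {W : ι → Ω → ℝ}
  (hind : iIndepFun W P) (hW : ∀ i, Measurable (W i)) (hT : 0 < T)
  (h : ∀ i, HasPsi2Bound P (W i) T)

include hind hW hT h

theorem measureReal_le_sum_sq_le :
    P.real {ω | 2 * T ^ 2 * Fintype.card ι ≤ ∑ i, W i ω ^ 2} ≤
      Real.exp (-(Fintype.card ι : ℝ)) := by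
  have hscale : ∀ i ω, 1 / T ^ 2 * W i ω ^ 2 = W i ω ^ 2 / T ^ 2 := fun i ω => by ring
  refine (measureReal_le_sum_le_exp (hind.comp (fun _ x => x ^ 2) fun _ => by fun_prop)
    (fun i => (hW i).pow_const 2) (t := 1 / T ^ 2) (a := 1) (by positivity)
    (fun i => ?_) (fun i => ?_) (2 * T ^ 2 * Fintype.card ι)).trans_eq ?_
  · simpa only [Function.comp_apply, hscale] using (h i).integrable
  · simp only [mgf, Function.comp_apply, hscale]
    linarith [(h i).integral_le, Real.add_one_le_exp (1 : ℝ)]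
  · congr 1
    field_simp
    ring

theorem measureReal_sum_sq_le_le (h1 : ∀ i, ∫ ω, W i ω ^ 2 ∂P = 1) :
    P.real {ω | ∑ i, W i ω ^ 2 ≤ Fintype.card ι / 4} ≤
      Real.exp (-(Fintype.card ι / (16 * T ^ 4))) := by
  have := hind.isProbabilityMeasure
  have hneg : {ω | ∑ i, W i ω ^ 2 ≤ Fintype.card ι / 4} =
      {ω | -(Fintype.card ι / 4 : ℝ) ≤ ∑ i, -W i ω ^ 2} := by
    simp only [Finset.sum_neg_distrib, neg_le_neg_iff]
  rw [hneg]
  refine (measureReal_le_sum_le_exp (hind.comp (fun _ x => -x ^ 2) fun _ => by fun_prop)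
    (fun i => ((hW i).pow_const 2).neg) (t := 1 / (4 * T ^ 4)) (a := -(1 / (8 * T ^ 4)))
    (by positivity) (fun i => ?_) (fun i => ?_) _).trans_eq ?_
  · have := hW i
    refine (integrable_const (1 : ℝ)).mono' (by fun_prop) (Filter.Eventually.of_forall fun ω => ?_)
    rw [Real.norm_eq_abs, Real.abs_exp, Real.exp_le_one_iff, Function.comp_apply]
    exact mul_nonpos_of_nonneg_of_nonpos (by positivity) (neg_nonpos.2 (sq_nonneg _))
  · refine le_of_eq_of_le ?_ ((h i).mgf_sq_le hT (h1 i))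
    simp only [mgf, Function.comp_apply, mul_neg, neg_mul]
  · congr 1
    field_simp
    ring

end SumSq

end Tail

/-! ### Random matrices with independent isotropic rows -/

section RandomMatrix

variable {Ω : Type*} [MeasurableSpace Ω] {P : Measure Ω} {ι κ : Type*} [Fintype ι] [Fintype κ]

/-- The one-dimensional marginals of the random vector `W` along unit vectors have second moment
one and ψ₂ norm at most `T`. -/
structure IsotropicPsi2Bound (P : Measure Ω) (W : Ω → κ → ℝ) (T : ℝ) : Prop where
  hasPsi2Bound : ∀ u, l2norm u = 1 → HasPsi2Bound P (fun ω => u ⬝ᵥ W ω) T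
  integral_sq : ∀ u, l2norm u = 1 → ∫ ω, (u ⬝ᵥ W ω) ^ 2 ∂P = 1

theorem l2norm_mulVec_sq (B : Matrix ι κ ℝ) (u : κ → ℝ) :
    l2norm (B *ᵥ u) ^ 2 = ∑ i, (u ⬝ᵥ B i) ^ 2 := by
  rw [l2norm_sq]
  exact Finset.sum_congr rfl fun i _ => by rw [Matrix.mulVec, dotProduct_comm, sq]

theorem gramBounds_of_isCover_sphere_of_sq {B : Matrix ι κ ℝ} {T N : ℝ}
    (hT : 1 ≤ T) (hN : 0 ≤ N) {δ : NNReal} (hδ : (δ : ℝ) = 1 / (16 * T))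
    {s : Set (EuclideanSpace ℝ κ)} (hs : Metric.IsCover δ (Metric.sphere 0 1) s)
    (hle : ∀ u ∈ s, l2norm (B *ᵥ u.ofLp) ^ 2 ≤ 2 * T ^ 2 * N)
    (hge : ∀ u ∈ s, N / 4 ≤ l2norm (B *ᵥ u.ofLp) ^ 2) :
    GramBounds B (N / 16) (8 * T ^ 2 * N) := by
  have : 0 < T := by linarith
  have hlo : √(N / 4) ^ 2 = N / 4 := Real.sq_sqrt (by positivity)
  have hhi : √(2 * T ^ 2 * N) ^ 2 = 2 * T ^ 2 * N := Real.sq_sqrt (by positivity)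
  have hgap : 2 * √(2 * T ^ 2 * N) * δ ≤ √(N / 4) / 2 := by
    refine le_of_sq_le_sq ?_ (by positivity)
    calc (2 * √(2 * T ^ 2 * N) * δ) ^ 2 = N / 32 := by
          rw [mul_pow, mul_pow, hhi, hδ]
          field_simp
          ring
      _ ≤ (√(N / 4) / 2) ^ 2 := by rw [div_pow, hlo]; linarith
  have hbounds := gramBounds_of_isCover_sphere (B := B) hs
    (by rw [hδ, div_le_div_iff₀] <;> linarith) (Real.sqrt_nonneg (2 * T ^ 2 * N))
    (hgap.trans (half_le_self (Real.sqrt_nonneg _)))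
    (fun u hu => Real.le_sqrt_of_sq_le (hle u hu))
    (fun u hu => Real.sqrt_le_iff.2 ⟨norm_nonneg _, hge u hu⟩)
  refine ⟨fun v => ?_, fun v => (hbounds.upper v).trans_eq ?_⟩
  · have hsq : (√(N / 4) / 2) ^ 2 ≤ (√(N / 4) - 2 * √(2 * T ^ 2 * N) * δ) ^ 2 :=
      pow_le_pow_left₀ (by positivity) (by linarith) 2
    rw [div_pow, hlo] at hsq
    exact (mul_le_mul_of_nonneg_right (by linarith) (dotProduct_self_nonneg v)).trans
      (hbounds.lower v)
  · rw [mul_pow, hhi]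
    ring

variable {V : ι → Ω → κ → ℝ} {T : ℝ} (hV : ∀ i, Measurable (V i)) (hind : iIndepFun V P)
  (hT : 1 ≤ T) (h : ∀ i, IsotropicPsi2Bound P (V i) T)

include hV hind hT h

theorem measureReal_sum_dotProduct_sq_notMem_Ioo_le {u : κ → ℝ} (hu : l2norm u = 1) :
    P.real {ω | ∑ i, (u ⬝ᵥ V i ω) ^ 2 ∉
        Set.Ioo (Fintype.card ι / 4 : ℝ) (2 * T ^ 2 * Fintype.card ι)} ≤
      2 * Real.exp (-(Fintype.card ι / (16 * T ^ 4))) := by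
  have := hind.isProbabilityMeasure
  have hT0 : 0 < T := by linarith
  have hdot : Measurable fun x : κ → ℝ => u ⬝ᵥ x := by simp only [dotProduct]; fun_prop
  have hind' : iIndepFun (fun i ω => u ⬝ᵥ V i ω) P := hind.comp (fun _ x => u ⬝ᵥ x) fun _ => hdot
  have hupper := measureReal_le_sum_sq_le hind' (fun i => hdot.comp (hV i)) hT0
    fun i => (h i).hasPsi2Bound u hu
  have hlower := measureReal_sum_sq_le_le hind' (fun i => hdot.comp (hV i)) hT0
    (fun i => (h i).hasPsi2Bound u hu) fun i => (h i).integral_sq u hu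
  have hrate : Real.exp (-(Fintype.card ι : ℝ)) ≤ Real.exp (-(Fintype.card ι / (16 * T ^ 4))) := by
    refine Real.exp_le_exp.2 (neg_le_neg (div_le_self (Nat.cast_nonneg _) ?_))
    linarith [one_le_pow₀ hT (n := 4)]
  calc _ ≤ P.real ({ω | 2 * T ^ 2 * Fintype.card ι ≤ ∑ i, (u ⬝ᵥ V i ω) ^ 2} ∪
        {ω | ∑ i, (u ⬝ᵥ V i ω) ^ 2 ≤ Fintype.card ι / 4}) := by
        refine measureReal_mono fun ω hω => ?_
        rw [Set.mem_ofPred_eq, Set.mem_Ioo, not_and_or, not_lt, not_lt, or_comm] at hω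
        exact hω
    _ ≤ _ := measureReal_union_le _ _
    _ ≤ _ := by linarith

theorem measureReal_not_gramBounds_le :
    P.real {ω | ¬ GramBounds (Matrix.of fun i => V i ω) (Fintype.card ι / 16)
        (8 * T ^ 2 * Fintype.card ι)} ≤
      (48 * T) ^ Fintype.card κ * (2 * Real.exp (-(Fintype.card ι / (16 * T ^ 4)))) := by
  have := hind.isProbabilityMeasure
  have : 0 < T := by linarith
  obtain ⟨δ, hδ⟩ : ∃ δ : NNReal, (δ : ℝ) = 1 / (16 * T) :=
    ⟨_, Real.coe_toNNReal _ (by positivity)⟩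
  have hδ0 : δ ≠ 0 := NNReal.coe_ne_zero.1 (by rw [hδ]; positivity)
  obtain ⟨s, hcard, hunit, hcover⟩ := exists_finset_isCover_card_le hδ0 zero_le_one
    (Metric.sphere_subset_closedBall (x := (0 : EuclideanSpace ℝ κ)) (ε := 1))
  have hcard' : (s.card : ℝ) ≤ (48 * T) ^ Fintype.card κ := by
    rw [finrank_euclideanSpace] at hcard
    refine hcard.trans (pow_le_pow_left₀ (by positivity) ?_ _)
    rw [hδ, div_div_eq_mul_div]
    linarith
  let bad (u : κ → ℝ) : Set Ω := {ω | ∑ i, (u ⬝ᵥ V i ω) ^ 2 ∉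
    Set.Ioo (Fintype.card ι / 4 : ℝ) (2 * T ^ 2 * Fintype.card ι)}
  have hsub : {ω | ¬ GramBounds (Matrix.of fun i => V i ω) (Fintype.card ι / 16)
      (8 * T ^ 2 * Fintype.card ι)} ⊆ ⋃ u ∈ s, bad u.ofLp := by
    intro ω hω
    by_contra hnot
    simp only [Set.mem_iUnion, not_exists] at hnot
    have hgood : ∀ u ∈ s, l2norm (Matrix.of (fun i => V i ω) *ᵥ u.ofLp) ^ 2 ∈
        Set.Ioo (Fintype.card ι / 4 : ℝ) (2 * T ^ 2 * Fintype.card ι) := fun u hu =>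
      l2norm_mulVec_sq (Matrix.of fun i => V i ω) u.ofLp ▸ not_not.1 (hnot u hu)
    exact hω (gramBounds_of_isCover_sphere_of_sq hT (Nat.cast_nonneg _) hδ hcover
      (fun u hu => (hgood u hu).2.le) fun u hu => (hgood u hu).1.le)
  calc P.real _ ≤ P.real (⋃ u ∈ s, bad u.ofLp) := measureReal_mono hsub (measure_ne_top _ _)
    _ ≤ ∑ u ∈ s, P.real (bad u.ofLp) := measureReal_biUnion_finset_le _ _
    _ ≤ ∑ _u ∈ s, 2 * Real.exp (-(Fintype.card ι / (16 * T ^ 4))) := Finset.sum_le_sum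
        fun u hu => measureReal_sum_dotProduct_sq_notMem_Ioo_le hV hind hT h
          (mem_sphere_zero_iff_norm.1 (hunit hu))
    _ = s.card * (2 * Real.exp (-(Fintype.card ι / (16 * T ^ 4)))) := by
        rw [Finset.sum_const, nsmul_eq_mul]
    _ ≤ _ := by gcongr

end RandomMatrix

theorem pow_mul_two_mul_exp_neg_le {b r x : ℝ} (hb : 0 < b) (hr : 0 < r) (hx : 0 < x) {K : ℕ}
    (hK : 2 * r * Real.log b * K ≤ x) : b ^ K * (2 * Real.exp (-(x / r))) ≤ 4 * r / x := by
  have hpow : b ^ K ≤ Real.exp (x / r / 2) := by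
    rw [← Real.exp_log hb, ← Real.exp_nat_mul]
    refine Real.exp_le_exp.2 ?_
    rw [div_div, le_div_iff₀ (by positivity)]
    linarith
  have hlin : x / r / 2 ≤ Real.exp (x / r / 2) := by linarith [Real.add_one_le_exp (x / r / 2)]
  calc b ^ K * (2 * Real.exp (-(x / r)))
      ≤ Real.exp (x / r / 2) * (2 * Real.exp (-(x / r))) := by gcongr
    _ = 2 * (Real.exp (x / r / 2))⁻¹ := by
        rw [← Real.exp_neg, mul_left_comm, ← Real.exp_add]
        ring_nf
    _ ≤ 2 * (x / r / 2)⁻¹ := by gcongr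
    _ = 4 * r / x := by field_simp; norm_num

/-! ### Linear images of random vectors -/

section LinearImages

variable {Ω : Type*} [MeasurableSpace Ω] {P : Measure Ω} {ι κ : Type*} [Fintype ι]

theorem measurable_dotProduct_left (w : ι → ℝ) : Measurable fun x : ι → ℝ => w ⬝ᵥ x :=
  (continuous_const.dotProduct continuous_id).measurable

theorem measurable_mulVec (B : Matrix κ ι ℝ) : Measurable fun x : ι → ℝ => B *ᵥ x :=
  measurable_pi_iff.2 fun k => measurable_dotProduct_left (B k)

variable {W : Ω → ι → ℝ} (hW : ∀ i, MemLp (fun ω => W ω i) 2 P)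

include hW

theorem memLp_dotProduct (w : ι → ℝ) : MemLp (fun ω => w ⬝ᵥ W ω) 2 P :=
  memLp_finsetSum _ fun i _ => (hW i).const_mul (w i)

variable [IsFiniteMeasure P] (hmean : ∀ i, ∫ ω, W ω i ∂P = 0)

include hmean

theorem integral_dotProduct_eq_zero (w : ι → ℝ) : ∫ ω, w ⬝ᵥ W ω ∂P = 0 := by
  simp only [dotProduct]
  rw [integral_finsetSum _ fun i _ => ((hW i).integrable one_le_two).const_mul _]
  simp [integral_const_mul, hmean]

theorem integral_dotProduct_sq (w : ι → ℝ) :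
    ∫ ω, (w ⬝ᵥ W ω) ^ 2 ∂P = w ⬝ᵥ (covMatrix P W *ᵥ w) := by
  have hmeas := (memLp_dotProduct hW w).aemeasurable
  rw [← variance_of_integral_eq_zero hmeas (integral_dotProduct_eq_zero hW hmean w),
    ← covariance_self hmeas]
  simp only [dotProduct]
  rw [covariance_fun_sum_fun_sum (fun i => (hW i).const_mul (w i))
    (fun i => (hW i).const_mul (w i))]
  simp only [covariance_const_mul_left, covariance_const_mul_right, covMatrix, Matrix.mulVec,
    dotProduct, Matrix.of_apply, Finset.mul_sum]
  exact Finset.sum_congr rfl fun i _ => Finset.sum_congr rfl fun j _ => by ring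

theorem ae_eq_zero_of_covMatrix_eq_zero (h : covMatrix P W = 0) : ∀ᵐ ω ∂P, W ω = 0 := by
  classical
  have hcoord : ∀ i, ∀ᵐ ω ∂P, W ω i = 0 := fun i => by
    have hsq := integral_dotProduct_sq hW hmean (Pi.single i 1)
    simp only [single_one_dotProduct, h, Matrix.zero_mulVec, dotProduct_zero] at hsq
    rw [integral_eq_zero_iff_of_nonneg (fun ω => sq_nonneg _) (hW i).integrable_sq] at hsq
    exact hsq.mono fun ω hω => sq_eq_zero_iff.1 hω
  exact (ae_all_iff.2 hcoord).mono fun ω hω => funext hω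

end LinearImages

theorem measureReal_lt_dotProduct_sq_le {Ω : Type*} [MeasurableSpace Ω] {P : Measure Ω}
    {ι : Type*} [Fintype ι] {e : ι → Ω → ℝ} (hind : iIndepFun e P) {c : NNReal}
    (h : ∀ i, HasSubgaussianMGF (e i) c P) {w : ι → ℝ} {d x : ℝ} (hw : w ⬝ᵥ w ≤ d) (hx : 0 ≤ x) :
    P.real {ω | 2 * c * d * x < (w ⬝ᵥ fun i => e i ω) ^ 2} ≤ 2 * Real.exp (-x) := by
  have := hind.isProbabilityMeasure
  have hd : 0 ≤ d := (dotProduct_self_nonneg w).trans hw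
  have hsum : HasSubgaussianMGF (fun ω => w ⬝ᵥ fun i => e i ω)
      (∑ i, .mk (w i ^ 2) (sq_nonneg _) * c) P :=
    HasSubgaussianMGF.sum_of_iIndepFun
      (hind.comp (fun i x => w i * x) fun i => by fun_prop) fun i _ => (h i).const_mul (w i)
  have hle : ∑ i, NNReal.mk (w i ^ 2) (sq_nonneg _) * c ≤ c * d.toNNReal := by
    rw [← Finset.sum_mul, mul_comm c, ← NNReal.coe_le_coe]
    push_cast
    rw [Real.coe_toNNReal _ hd]
    gcongr
    simpa only [NNReal.coe_mk, dotProduct, sq] using hw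
  have htail := measureReal_lt_sq_le (hasSubgaussianMGF_mono hsum hle) hx
  rwa [NNReal.coe_mul, Real.coe_toNNReal _ hd, ← mul_assoc] at htail

theorem measurable_leftInv {ι κ : Type*} [Fintype ι] [Fintype κ] [DecidableEq κ] (k : κ) (i : ι) :
    Measurable fun x : ι → κ → ℝ => leftInv (Matrix.of x) k i := by
  have hgram : Continuous fun x : ι → κ → ℝ => (Matrix.of x)ᵀ * Matrix.of x :=
    continuous_matrix fun a b => by
      simp only [Matrix.mul_apply, Matrix.transpose_apply, Matrix.of_apply]
      fun_prop
  have hadjugate : ∀ a b, Measurable fun x : ι → κ → ℝ =>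
      ((Matrix.of x)ᵀ * Matrix.of x).adjugate a b := fun a b =>
    (hgram.matrix_adjugate.matrix_elem a b).measurable
  have hdet : Measurable fun x : ι → κ → ℝ => ((Matrix.of x)ᵀ * Matrix.of x).det :=
    hgram.matrix_det.measurable
  simp only [leftInv, Matrix.inv_def, Ring.inverse_eq_inv', Matrix.smul_mul, Matrix.smul_apply,
    smul_eq_mul, Matrix.mul_apply (M := Matrix.adjugate _), Matrix.transpose_apply,
    Matrix.of_apply]
  fun_prop

/-! ### Independent random functions -/

section Independence

variable {Ω : Type*} [MeasurableSpace Ω] {P : Measure Ω} {α β : Type*} [MeasurableSpace α]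
  [MeasurableSpace β]

theorem indepFun_pi_of_iIndepFun_prodMk {ι : Type*} [Finite ι] {f : ι → Ω → α} {g : ι → Ω → β}
    (hf : ∀ i, Measurable (f i)) (hg : ∀ i, Measurable (g i))
    (h : iIndepFun (fun i ω => (f i ω, g i ω)) P) (hfg : ∀ i, IndepFun (f i) (g i) P) :
    IndepFun (fun ω i => f i ω) (fun ω i => g i ω) P := by
  cases nonempty_fintype ι
  have := h.isProbabilityMeasure
  have : ∀ i, IsProbabilityMeasure (P.map (f i)) :=
    fun i => Measure.isProbabilityMeasure_map (hf i).aemeasurable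
  have : ∀ i, IsProbabilityMeasure (P.map (g i)) :=
    fun i => Measure.isProbabilityMeasure_map (hg i).aemeasurable
  have hmap_f : P.map (fun ω i => f i ω) = Measure.pi fun i => P.map (f i) :=
    (iIndepFun_iff_map_fun_eq_pi_map fun i => (hf i).aemeasurable).1
      (h.comp (fun _ => Prod.fst) fun _ => measurable_fst)
  have hmap_g : P.map (fun ω i => g i ω) = Measure.pi fun i => P.map (g i) :=
    (iIndepFun_iff_map_fun_eq_pi_map fun i => (hg i).aemeasurable).1
      (h.comp (fun _ => Prod.snd) fun _ => measurable_snd)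
  have hmap_pair : ∀ i, P.map (fun ω => (f i ω, g i ω)) = (P.map (f i)).prod (P.map (g i)) :=
    fun i => (indepFun_iff_map_prod_eq_prod_map_map (hf i).aemeasurable
      (hg i).aemeasurable).1 (hfg i)
  have hmap : P.map (fun ω i => (f i ω, g i ω)) =
      Measure.pi fun i => (P.map (f i)).prod (P.map (g i)) := by
    simpa only [hmap_pair] using (iIndepFun_iff_map_fun_eq_pi_map
      fun i => ((hf i).prodMk (hg i)).aemeasurable).1 h
  rw [indepFun_iff_map_prod_eq_prod_map_map (measurable_pi_iff.2 hf).aemeasurable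
    (measurable_pi_iff.2 hg).aemeasurable, hmap_f, hmap_g,
    ← (measurePreserving_arrowProdEquivProdArrow α β ι _ _).map_eq, ← hmap,
    Measure.map_map (MeasurableEquiv.measurable _)
      (measurable_pi_iff.2 fun i => (hf i).prodMk (hg i))]
  rfl

variable [IsProbabilityMeasure P] {f : Ω → α}

theorem measureReal_prodMk_mem_le_of_indepFun {g : Ω → β} (hf : Measurable f) (hg : Measurable g)
    (h : IndepFun f g P) {s : Set (α × β)} (hs : MeasurableSet s) {q : ℝ} (hq : 0 ≤ q)
    (hb : ∀ x, P.real {ω | (x, g ω) ∈ s} ≤ q) : P.real {ω | (f ω, g ω) ∈ s} ≤ q := by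
  have : IsProbabilityMeasure (P.map f) := Measure.isProbabilityMeasure_map hf.aemeasurable
  have : IsProbabilityMeasure (P.map g) := Measure.isProbabilityMeasure_map hg.aemeasurable
  have hsection : ∀ x, (P.map g) (Prod.mk x ⁻¹' s) ≤ ENNReal.ofReal q := fun x => by
    rw [Measure.map_apply hg (measurable_prodMk_left hs)]
    exact (ENNReal.le_ofReal_iff_toReal_le (measure_ne_top _ _) hq).2 (hb x)
  refine ENNReal.toReal_le_of_le_ofReal hq ?_
  calc P {ω | (f ω, g ω) ∈ s} = (P.map fun ω => (f ω, g ω)) s :=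
        (Measure.map_apply (hf.prodMk hg) hs).symm
    _ = ∫⁻ x, (P.map g) (Prod.mk x ⁻¹' s) ∂(P.map f) := by
        rw [(indepFun_iff_map_prod_eq_prod_map_map hf.aemeasurable hg.aemeasurable).1 h,
          Measure.prod_apply hs]
    _ ≤ ∫⁻ _x, ENNReal.ofReal q ∂(P.map f) := lintegral_mono hsection
    _ = ENNReal.ofReal q := by simp

theorem measureReal_dotProduct_self_le_and_lt_sq_le {ι : Type*} [Fintype ι] {g : Ω → ι → ℝ}
    (hf : Measurable f) (hg : Measurable g) (h : IndepFun f g P) {G : α → ι → ℝ}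
    (hG : Measurable G) {d t q : ℝ} (hq : 0 ≤ q)
    (hb : ∀ w : ι → ℝ, w ⬝ᵥ w ≤ d → P.real {ω | t < (w ⬝ᵥ g ω) ^ 2} ≤ q) :
    P.real {ω | G (f ω) ⬝ᵥ G (f ω) ≤ d ∧ t < (G (f ω) ⬝ᵥ g ω) ^ 2} ≤ q := by
  have hs : MeasurableSet {z : α × (ι → ℝ) |
      G z.1 ⬝ᵥ G z.1 ≤ d ∧ t < (G z.1 ⬝ᵥ z.2) ^ 2} := by
    simp only [dotProduct]
    measurability
  refine measureReal_prodMk_mem_le_of_indepFun hf hg h hs hq fun x => ?_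
  by_cases hx : G x ⬝ᵥ G x ≤ d
  · exact (measureReal_mono fun ω hω => hω.2).trans (hb _ hx)
  · simpa only [Set.mem_ofPred_eq, hx, false_and, Set.ofPred_false, measureReal_empty] using hq

end Independence

/-! ### The factor regression model without feature noise -/

namespace Model

variable {Ω : Type*} [MeasurableSpace Ω] {P : Measure Ω} {n p K : ℕ} (M : Model P n p K)

theorem identDistrib_Z (i : Option (Fin n)) : IdentDistrib (M.Z i) (M.Z none) P P :=
  (M.identDistrib i).comp (u := Prod.fst) measurable_fst

theorem identDistrib_E (i : Option (Fin n)) : IdentDistrib (M.E i) (M.E none) P P :=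
  (M.identDistrib i).comp (u := fun x : _ × _ × _ => x.2.1) (by fun_prop)

theorem identDistrib_ε (i : Option (Fin n)) : IdentDistrib (M.ε i) (M.ε none) P P :=
  (M.identDistrib i).comp (u := fun x : _ × _ × _ => x.2.2) (by fun_prop)

theorem memLp_ε_apply (i : Option (Fin n)) : MemLp (M.ε i) 2 P :=
  (M.identDistrib_ε i).memLp_iff.2 M.memLp_ε

theorem noiseVar_nonneg : 0 ≤ M.noiseVar := variance_nonneg _ _

theorem dataX_eq_dataZ_mul {ω : Ω} (hω : ∀ i, M.E i ω = 0) : M.dataX ω = M.dataZ ω * M.Aᵀ := by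
  ext i j
  simp [dataX, dataZ, X, hω, Matrix.mul_apply, Matrix.mulVec, dotProduct, mul_comm]

theorem X_dotProduct_eq {i : Option (Fin n)} {ω : Ω} (hω : M.E i ω = 0) (α : Fin p → ℝ) :
    M.X i ω ⬝ᵥ α = M.Z i ω ⬝ᵥ (M.Aᵀ *ᵥ α) := by
  rw [X, hω, add_zero, Matrix.dotProduct_transpose_mulVec, dotProduct_comm]

theorem injective_A_mulVec (hA : M.A.rank = K) : Function.Injective M.A.mulVec :=
  rank_eq_card_iff_mulVec_injective.1 (hA.trans (Fintype.card_fin K).symm)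

variable [IsFiniteMeasure P]

theorem ae_E_eq_zero (hE : M.covE = 0) : ∀ᵐ ω ∂P, ∀ i, M.E i ω = 0 :=
  ae_all_iff.2 fun i => (M.identDistrib_E i).symm.ae_mem_snd (t := {0}) (measurableSet_singleton _)
    (ae_eq_zero_of_covMatrix_eq_zero (fun j => M.memLp_E.eval j) M.mean_E hE)

theorem risk_eq_integral_dotProduct_Z (hE : M.covE = 0) (α : Fin p → ℝ) :
    M.risk α = ∫ ω, (M.Z none ω ⬝ᵥ (M.Aᵀ *ᵥ α) - M.y none ω) ^ 2 ∂P :=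
  integral_congr_ae <| (M.ae_E_eq_zero hE).mono fun ω hω => by
    simp only [M.X_dotProduct_eq (hω none)]

theorem integral_dotProduct_Z_sub_y_sq (u : Fin K → ℝ) :
    ∫ ω, (M.Z none ω ⬝ᵥ u - M.y none ω) ^ 2 ∂P =
      (u - M.β) ⬝ᵥ (M.covZ *ᵥ (u - M.β)) + M.noiseVar := by
  set w := u - M.β with hw
  have hZ : MemLp (fun ω => w ⬝ᵥ M.Z none ω) 2 P :=
    memLp_dotProduct (fun k => M.memLp_Z.eval k) w
  have hcross : ∫ ω, (w ⬝ᵥ M.Z none ω) * M.ε none ω ∂P = 0 := by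
    have hind : IndepFun (fun ω => w ⬝ᵥ M.Z none ω) (M.ε none) P :=
      M.indep_Z.comp (measurable_dotProduct_left w) measurable_snd
    rw [hind.integral_fun_mul_eq_mul_integral hZ.aestronglyMeasurable
      M.memLp_ε.aestronglyMeasurable, M.mean_ε, mul_zero]
  have hexpand : ∀ ω, (M.Z none ω ⬝ᵥ u - M.y none ω) ^ 2 = (w ⬝ᵥ M.Z none ω) ^ 2 -
      2 * ((w ⬝ᵥ M.Z none ω) * M.ε none ω) + M.ε none ω ^ 2 := fun ω => by
    rw [y, hw, dotProduct_comm (u - M.β), dotProduct_sub]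
    ring
  have hZ2 := hZ.integrable_sq
  have hZε : Integrable (fun ω => (w ⬝ᵥ M.Z none ω) * M.ε none ω) P := hZ.integrable_mul M.memLp_ε
  simp only [hexpand]
  rw [integral_add (by fun_prop) M.memLp_ε.integrable_sq, integral_sub hZ2 (hZε.const_mul 2),
    integral_const_mul, hcross, mul_zero, sub_zero, noiseVar,
    variance_of_integral_eq_zero M.memLp_ε.aemeasurable M.mean_ε]
  exact congrArg (· + _) (integral_dotProduct_sq (fun k => M.memLp_Z.eval k) M.mean_Z w)

theorem ae_prediction_eq_and_risk_eq (hE : M.covE = 0) (hA : M.A.rank = K) :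
    ∀ᵐ ω ∂P, (M.dataZ ω).rank = K →
      M.X none ω ⬝ᵥ M.αHat ω = M.Z none ω ⬝ᵥ M.βHat ω ∧
      M.risk (M.αHat ω) = ∫ ω', (M.Z none ω' ⬝ᵥ M.βHat ω - M.y none ω') ^ 2 ∂P := by
  filter_upwards [M.ae_E_eq_zero hE] with ω hω hrank
  have hZ : Function.Injective (M.dataZ ω).mulVec :=
    rank_eq_card_iff_mulVec_injective.1 (hrank.trans (Fintype.card_fin K).symm)
  have hls := (minNormLS_spec (M.dataX ω) (M.dataY ω)).1
  nth_rewrite 1 [M.dataX_eq_dataZ_mul hω] at hls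
  have hcoeff : M.Aᵀ *ᵥ M.αHat ω = M.βHat ω := by
    rw [βHat, pinv_eq_leftInv hZ]
    exact (hls.of_mul_transpose (M.injective_A_mulVec hA)).eq_leftInv_mulVec hZ
  exact ⟨by rw [M.X_dotProduct_eq (hω none), hcoeff],
    by rw [M.risk_eq_integral_dotProduct_Z hE, hcoeff]⟩

end Model

/-! ### Whitened factors -/

section Whitening

variable {k : Type*} [Fintype k]

theorem dotProduct_mul_transpose_mulVec {l : Type*} [Fintype l] (S : Matrix k l ℝ) (w : k → ℝ) :
    w ⬝ᵥ ((S * Sᵀ) *ᵥ w) = (Sᵀ *ᵥ w) ⬝ᵥ (Sᵀ *ᵥ w) := by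
  rw [← Matrix.mulVec_mulVec, Matrix.dotProduct_mulVec, ← Matrix.mulVec_transpose]

theorem isUnit_det_of_rank_mul_transpose [DecidableEq k] {S : Matrix k k ℝ}
    (h : (S * Sᵀ).rank = Fintype.card k) : IsUnit S.det := by
  have hmul := (Matrix.isUnit_iff_isUnit_det _).1
    (Matrix.mulVec_injective_iff_isUnit.1 (rank_eq_card_iff_mulVec_injective.1 h))
  rw [Matrix.det_mul] at hmul
  exact isUnit_of_mul_isUnit_left hmul

end Whitening

namespace Model

variable {Ω : Type*} [MeasurableSpace Ω] {P : Measure Ω} {n p K : ℕ} (M : Model P n p K)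

/-- The factors `S⁻¹ Z_i`; they have identity covariance when `S Sᵀ = Σ_Z`. -/
noncomputable def whitened (S : Matrix (Fin K) (Fin K) ℝ) (i : Option (Fin n)) (ω : Ω) :
    Fin K → ℝ :=
  S⁻¹ *ᵥ M.Z i ω

/-- The `n × K` matrix whose rows are the whitened training factors. -/
noncomputable def whitenedData (S : Matrix (Fin K) (Fin K) ℝ) (ω : Ω) :
    Matrix (Fin n) (Fin K) ℝ :=
  Matrix.of fun i => M.whitened S (some i) ω

variable {S : Matrix (Fin K) (Fin K) ℝ}

theorem dataZ_eq_whitenedData_mul (hdet : IsUnit S.det) (ω : Ω) :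
    M.dataZ ω = M.whitenedData S ω * Sᵀ := by
  ext i j
  change M.Z (some i) ω j = (M.whitened S (some i) ω ᵥ* Sᵀ) j
  rw [Matrix.vecMul_transpose, whitened, Matrix.mulVec_mulVec, Matrix.mul_nonsing_inv _ hdet,
    Matrix.one_mulVec]

theorem rank_dataZ_eq (hdet : IsUnit S.det) {ω : Ω}
    (hV : Function.Injective (M.whitenedData S ω).mulVec) : (M.dataZ ω).rank = K := by
  refine (rank_eq_card_iff_mulVec_injective.2 ?_).trans (Fintype.card_fin K)
  have hST : Function.Injective Sᵀ.mulVec := Matrix.mulVec_injective_iff_isUnit.2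
    ((Matrix.isUnit_iff_isUnit_det _).2 (Matrix.isUnit_det_transpose S hdet))
  rw [M.dataZ_eq_whitenedData_mul hdet]
  intro v w hvw
  simp only [← Matrix.mulVec_mulVec] at hvw
  exact hST (hV hvw)

theorem risk_minNormLS [IsFiniteMeasure P] (hE : M.covE = 0) (hA : M.A.rank = K)
    (hS : S * Sᵀ = M.covZ) (hdet : IsUnit S.det) {ω : Ω} (hω : ∀ i, M.E i ω = 0)
    (hV : Function.Injective (M.whitenedData S ω).mulVec) (e : Fin n → ℝ) :
    M.risk (minNormLS (M.dataX ω) (M.dataZ ω *ᵥ M.β + e)) =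
      ∑ k, (leftInv (M.whitenedData S ω) k ⬝ᵥ e) ^ 2 + M.noiseVar := by
  set V := M.whitenedData S ω
  set α := minNormLS (M.dataX ω) (M.dataZ ω *ᵥ M.β + e)
  have hZ : M.dataZ ω = V * Sᵀ := M.dataZ_eq_whitenedData_mul hdet ω
  have hSinj : Function.Injective S.mulVec :=
    Matrix.mulVec_injective_iff_isUnit.2 ((Matrix.isUnit_iff_isUnit_det S).2 hdet)
  have hls : IsLeastSquares (V * Sᵀ * M.Aᵀ) (V *ᵥ (Sᵀ *ᵥ M.β) + e) α := by
    rw [Matrix.mulVec_mulVec, ← hZ, ← M.dataX_eq_dataZ_mul hω]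
    exact (minNormLS_spec _ _).1
  have hcoeff : Sᵀ *ᵥ (M.Aᵀ *ᵥ α - M.β) = leftInv V *ᵥ e := by
    have := ((hls.of_mul_transpose (M.injective_A_mulVec hA)).of_mul_transpose
      hSinj).eq_leftInv_mulVec hV
    rw [Matrix.mulVec_sub, this, Matrix.mulVec_add, Matrix.mulVec_mulVec _ (leftInv V) V,
      leftInv_mul hV, Matrix.one_mulVec, add_sub_cancel_left]
  rw [M.risk_eq_integral_dotProduct_Z hE, M.integral_dotProduct_Z_sub_y_sq, ← hS,
    dotProduct_mul_transpose_mulVec, hcoeff]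
  simp [dotProduct, Matrix.mulVec, sq]

theorem measurable_whitened (S : Matrix (Fin K) (Fin K) ℝ) (i : Option (Fin n)) :
    Measurable (M.whitened S i) :=
  (measurable_mulVec S⁻¹).comp (M.measurable_Z i)

theorem iIndepFun_whitened (S : Matrix (Fin K) (Fin K) ℝ) :
    iIndepFun (fun i => M.whitened S (some i)) P :=
  (M.iIndep.precomp (Option.some_injective _)).comp (fun _ x => S⁻¹ *ᵥ x.1)
    fun _ => (measurable_mulVec S⁻¹).comp measurable_fst

theorem integral_dotProduct_whitened_sq [IsFiniteMeasure P] (hS : S * Sᵀ = M.covZ)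
    (hdet : IsUnit S.det) (u : Fin K → ℝ) :
    ∫ ω, (u ⬝ᵥ M.whitened S none ω) ^ 2 ∂P = u ⬝ᵥ u := by
  simp only [whitened, Matrix.dotProduct_mulVec]
  rw [integral_dotProduct_sq (fun k => M.memLp_Z.eval k) M.mean_Z]
  change _ ⬝ᵥ (M.covZ *ᵥ _) = _
  rw [← hS, dotProduct_mul_transpose_mulVec, Matrix.mulVec_transpose, Matrix.vecMul_vecMul,
    Matrix.nonsing_inv_mul _ hdet, Matrix.vecMul_one]

theorem isotropicPsi2Bound_whitened [IsFiniteMeasure P] (hS : S * Sᵀ = M.covZ)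
    (hdet : IsUnit S.det) {L T : ℝ} (hT : 0 < T) (hLT : L < T) {Zt : Ω → Fin K → ℝ}
    (hZt : Measurable Zt) (hZ : ∀ᵐ ω ∂P, M.Z none ω = S *ᵥ Zt ω)
    (hpsi : psi2NormVec P Zt ≤ ENNReal.ofReal L) (i : Option (Fin n)) :
    IsotropicPsi2Bound P (M.whitened S i) T := by
  have hident : ∀ u, IdentDistrib (fun ω => u ⬝ᵥ M.whitened S i ω)
      (fun ω => u ⬝ᵥ M.whitened S none ω) P P := fun u =>
    (M.identDistrib_Z i).comp ((measurable_dotProduct_left u).comp (measurable_mulVec S⁻¹))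
  refine ⟨fun u hu => ?_, fun u hu => ?_⟩
  · have hpsi_u : psi2Norm P (fun ω => u ⬝ᵥ Zt ω) < ENNReal.ofReal T :=
      (le_iSup₂ (f := fun (v : Fin K → ℝ) (_ : l2norm v = 1) => psi2Norm P fun ω => v ⬝ᵥ Zt ω)
        u hu).trans_lt (hpsi.trans_lt ((ENNReal.ofReal_lt_ofReal_iff hT).2 hLT))
    have hmeas : Measurable fun ω => u ⬝ᵥ Zt ω := (measurable_dotProduct_left u).comp hZt
    have hae : (fun ω => u ⬝ᵥ Zt ω) =ᵐ[P] fun ω => u ⬝ᵥ M.whitened S none ω := by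
      filter_upwards [hZ] with ω hω
      rw [whitened, hω, Matrix.mulVec_mulVec, Matrix.nonsing_inv_mul _ hdet, Matrix.one_mulVec]
    exact (hasPsi2Bound_of_psi2Norm_lt hmeas hpsi_u).congr_identDistrib
      ((IdentDistrib.of_ae_eq hmeas.aemeasurable hae).trans (hident u).symm)
  · refine ((hident u).comp (u := fun x => x ^ 2) (by fun_prop)).integral_eq.trans ?_
    exact (M.integral_dotProduct_whitened_sq hS hdet u).trans (by rw [← l2norm_sq, hu, one_pow])

/-! ### The training noise -/

theorem measurable_dataε : Measurable M.dataε :=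
  measurable_pi_iff.2 fun i => M.measurable_ε (some i)

theorem iIndepFun_ε : iIndepFun (fun i => M.ε (some i)) P :=
  (M.iIndep.precomp (Option.some_injective _)).comp (fun _ x => x.2.2) fun _ => by fun_prop

theorem indepFun_Z_ε [IsFiniteMeasure P] (i : Option (Fin n)) : IndepFun (M.Z i) (M.ε i) P :=
  indepFun_of_identDistrib_pair
    (M.indep_Z.comp (φ := id) (ψ := Prod.snd) measurable_id measurable_snd)
    ((M.identDistrib i).comp (u := fun x : _ × _ × _ => (x.1, x.2.2)) (by fun_prop)).symm

theorem indepFun_whitened_dataε [IsFiniteMeasure P] (S : Matrix (Fin K) (Fin K) ℝ) :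
    IndepFun (fun ω i => M.whitened S (some i) ω) M.dataε P :=
  indepFun_pi_of_iIndepFun_prodMk (fun i => M.measurable_whitened S (some i))
    (fun i => M.measurable_ε (some i))
    ((M.iIndep.precomp (Option.some_injective _)).comp (fun _ x => (S⁻¹ *ᵥ x.1, x.2.2))
      fun _ => ((measurable_mulVec S⁻¹).comp measurable_fst).prodMk (by fun_prop))
    fun i => (M.indepFun_Z_ε (some i)).comp (measurable_mulVec S⁻¹) measurable_id

theorem covMatrix_dataε : covMatrix P M.dataε = M.noiseVar • (1 : Matrix (Fin n) (Fin n) ℝ) := by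
  ext i j
  change cov[M.ε (some i), M.ε (some j); P] = M.noiseVar * (1 : Matrix (Fin n) (Fin n) ℝ) i j
  obtain rfl | hij := eq_or_ne i j
  · rw [Matrix.one_apply_eq, mul_one, covariance_self (M.measurable_ε _).aemeasurable]
    exact (M.identDistrib_ε (some i)).variance_eq
  · rw [Matrix.one_apply_ne hij, mul_zero]
    exact (M.iIndepFun_ε.indepFun hij).covariance_eq_zero (M.memLp_ε_apply _) (M.memLp_ε_apply _)

theorem integral_dotProduct_dataε_sq [IsFiniteMeasure P] (w : Fin n → ℝ) :
    ∫ ω, (w ⬝ᵥ M.dataε ω) ^ 2 ∂P = M.noiseVar * (w ⬝ᵥ w) := by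
  rw [integral_dotProduct_sq (W := M.dataε) (fun i => M.memLp_ε_apply (some i))
    fun i => (M.identDistrib_ε (some i)).integral_eq.trans M.mean_ε]
  rw [covMatrix_dataε, Matrix.smul_mulVec, Matrix.one_mulVec, dotProduct_smul, smul_eq_mul]

theorem hasSubgaussianMGF_ε [IsProbabilityMeasure P] {T : ℝ} (hT : 0 < T) {εt : Ω → ℝ}
    (hmeas : Measurable εt) (hε : ∀ᵐ ω ∂P, M.ε none ω = √M.noiseVar * εt ω)
    (hmean : ∫ ω, εt ω ∂P = 0) (hpsi : psi2Norm P εt < ENNReal.ofReal T) (i : Option (Fin n)) :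
    HasSubgaussianMGF (M.ε i) (M.noiseVar.toNNReal * (2 * T.toNNReal ^ 2)) P := by
  have hscaled := ((hasPsi2Bound_of_psi2Norm_lt hmeas hpsi).hasSubgaussianMGF hmeas hT
    hmean).const_mul √M.noiseVar
  have hcoeff : NNReal.mk (√M.noiseVar ^ 2) (sq_nonneg _) = M.noiseVar.toNNReal := by
    ext
    rw [NNReal.coe_mk, Real.sq_sqrt M.noiseVar_nonneg, Real.coe_toNNReal _ M.noiseVar_nonneg]
  exact hcoeff ▸ (hscaled.congr (hε.mono fun ω h => h.symm)).congr_identDistrib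
    (M.identDistrib_ε i).symm

theorem measureReal_leftInv_dataε_le [IsProbabilityMeasure P] {c : NNReal}
    (hε : ∀ i, HasSubgaussianMGF (M.ε (some i)) c P) (S : Matrix (Fin K) (Fin K) ℝ) {d x : ℝ}
    (hx : 0 ≤ x) (k : Fin K) :
    P.real {ω | leftInv (M.whitenedData S ω) k ⬝ᵥ leftInv (M.whitenedData S ω) k ≤ d ∧
      2 * c * d * x < (leftInv (M.whitenedData S ω) k ⬝ᵥ M.dataε ω) ^ 2} ≤ 2 * Real.exp (-x) :=
  measureReal_dotProduct_self_le_and_lt_sq_le (f := fun ω i => M.whitened S (some i) ω)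
    (measurable_pi_iff.2 fun i => M.measurable_whitened S (some i)) M.measurable_dataε
    (M.indepFun_whitened_dataε S) (G := fun x => leftInv (Matrix.of x) k)
    (measurable_pi_iff.2 fun i => measurable_leftInv k i) (by positivity)
    fun _ hw => measureReal_lt_dotProduct_sq_le M.iIndepFun_ε hε hw hx

end Model

/-- The ratio `n / K` beyond which, for whitened factors of ψ₂ norm at most `T`, the union bound
over a net of the unit sphere leaves a failure probability of order `1 / n`. -/
noncomputable def sampleRatio (T : ℝ) : ℝ := 32 * T ^ 4 * Real.log (48 * T)

theorem one_le_sampleRatio {T : ℝ} (hT : 1 ≤ T) : 1 ≤ sampleRatio T := by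
  have hpow : 1 ≤ T ^ 4 := one_le_pow₀ hT
  have hinv : (48 * T)⁻¹ ≤ 1 / 2 := by
    rw [inv_le_comm₀ (by positivity) (by norm_num)]
    linarith
  have hlog : 1 / 32 ≤ Real.log (48 * T) := by
    linarith [Real.one_sub_inv_le_log_of_pos (show 0 < 48 * T by positivity)]
  calc (1 : ℝ) = 32 * 1 * (1 / 32) := by norm_num
    _ ≤ sampleRatio T := by rw [sampleRatio]; gcongr

namespace Model

/-! ### Risk bounds -/

variable {Ω : Type*} [MeasurableSpace Ω] {P : Measure Ω} {n p K : ℕ}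
  (M : Model P n p K) {S : Matrix (Fin K) (Fin K) ℝ} {ω : Ω}

theorem integrable_dotProduct_dataε_sq (w : Fin n → ℝ) :
    Integrable (fun ω => (w ⬝ᵥ M.dataε ω) ^ 2) P :=
  (memLp_dotProduct (W := M.dataε) (fun i => M.memLp_ε_apply (some i)) w).integrable_sq

theorem measureReal_not_gramBounds_whitenedData_le {T : ℝ} (hT : 1 ≤ T)
    (hpsi : ∀ i, IsotropicPsi2Bound P (M.whitened S i) T) (hn : 0 < n)
    (hKn : sampleRatio T * K ≤ n) :
    P.real {ω | ¬ GramBounds (M.whitenedData S ω) (1 / 16 * n) (8 * T ^ 2 * n)} ≤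
      64 * T ^ 4 / n := by
  have hprob := measureReal_not_gramBounds_le (fun i => M.measurable_whitened S (some i))
    (M.iIndepFun_whitened S) hT fun i => hpsi (some i)
  rw [Fintype.card_fin, Fintype.card_fin, div_eq_mul_one_div, mul_comm (n : ℝ)] at hprob
  have hdecay := pow_mul_two_mul_exp_neg_le (b := 48 * T) (r := 16 * T ^ 4) (x := n) (K := K)
    (by positivity) (by positivity) (by exact_mod_cast hn)
    ((by rw [sampleRatio]; ring : _ = sampleRatio T * K).trans_le hKn)
  exact hprob.trans (hdecay.trans_eq (by ring))

variable [IsProbabilityMeasure P]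

theorem riskResampled_eq (hE : M.covE = 0) (hA : M.A.rank = K) (hS : S * Sᵀ = M.covZ)
    (hdet : IsUnit S.det) (hω : ∀ i, M.E i ω = 0)
    (hV : Function.Injective (M.whitenedData S ω).mulVec) :
    M.riskResampled ω = fun ω' =>
      ∑ k, (leftInv (M.whitenedData S ω) k ⬝ᵥ M.dataε ω') ^ 2 + M.noiseVar :=
  funext fun _ => M.risk_minNormLS hE hA hS hdet hω hV _

theorem integrable_riskResampled (hE : M.covE = 0) (hA : M.A.rank = K) (hS : S * Sᵀ = M.covZ)
    (hdet : IsUnit S.det) (hω : ∀ i, M.E i ω = 0)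
    (hV : Function.Injective (M.whitenedData S ω).mulVec) :
    Integrable (M.riskResampled ω) P := by
  rw [M.riskResampled_eq hE hA hS hdet hω hV]
  exact (integrable_finsetSum _ fun k _ => M.integrable_dotProduct_dataε_sq _).add
    (integrable_const _)

theorem noiseMeanRisk_eq (hE : M.covE = 0) (hA : M.A.rank = K) (hS : S * Sᵀ = M.covZ)
    (hdet : IsUnit S.det) (hω : ∀ i, M.E i ω = 0)
    (hV : Function.Injective (M.whitenedData S ω).mulVec) :
    M.noiseMeanRisk ω = M.noiseVar *
      ∑ k, leftInv (M.whitenedData S ω) k ⬝ᵥ leftInv (M.whitenedData S ω) k + M.noiseVar := by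
  have hint : ∀ k, Integrable
      (fun ω' => (leftInv (M.whitenedData S ω) k ⬝ᵥ M.dataε ω') ^ 2) P :=
    fun k => M.integrable_dotProduct_dataε_sq _
  rw [noiseMeanRisk, M.riskResampled_eq hE hA hS hdet hω hV,
    integral_add (integrable_finsetSum _ fun k _ => hint k) (integrable_const _),
    integral_finsetSum _ fun k _ => hint k]
  simp only [integral_dotProduct_dataε_sq, Finset.mul_sum, integral_const, probReal_univ, one_smul]

/-- The conclusion of the second part of the theorem at the outcome `ω` of the training data:
`𝐙` has rank `K`, the excess risk is at most `c₁ σ_ε² K log n / n`, and its (finite) mean over the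
training noise is at least `c₂ σ_ε² K / n`. -/
def RiskBounds (c₁ c₂ : ℝ) (ω : Ω) : Prop :=
  (M.dataZ ω).rank = K ∧
    M.risk (M.αHat ω) - M.noiseVar ≤
      c₁ * (M.noiseVar * ((K : ℝ) * Real.log (n : ℝ) / (n : ℝ))) ∧
    Integrable (M.riskResampled ω) P ∧
    M.noiseMeanRisk ω - M.noiseVar ≥ c₂ * (M.noiseVar * ((K : ℝ) / (n : ℝ)))

theorem riskBounds_of_gramBounds (hE : M.covE = 0) (hA : M.A.rank = K) (hS : S * Sᵀ = M.covZ)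
    (hdet : IsUnit S.det) (hω : ∀ i, M.E i ω = 0) (hn : 0 < n) {a b d : ℝ} (ha : 0 < a)
    (hb : 0 < b) (hV : GramBounds (M.whitenedData S ω) (a * n) (b * n))
    (hnoise : ∀ k, (leftInv (M.whitenedData S ω) k ⬝ᵥ M.dataε ω) ^ 2 ≤
      d * M.noiseVar * (Real.log n / n)) :
    M.RiskBounds d (1 / b) ω := by
  have hn0 : (0 : ℝ) < n := by exact_mod_cast hn
  have hinj := mulVec_injective_of_le (mul_pos ha hn0) hV.lower
  refine ⟨M.rank_dataZ_eq hdet hinj, ?_, M.integrable_riskResampled hE hA hS hdet hω hinj, ?_⟩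
  · have hrisk : M.risk (M.αHat ω) =
        ∑ k, (leftInv (M.whitenedData S ω) k ⬝ᵥ M.dataε ω) ^ 2 + M.noiseVar :=
      M.risk_minNormLS hE hA hS hdet hω hinj (M.dataε ω)
    rw [hrisk, add_sub_cancel_right]
    calc _ ≤ ∑ _k : Fin K, d * M.noiseVar * (Real.log n / n) :=
          Finset.sum_le_sum fun k _ => hnoise k
      _ = _ := by
          rw [Finset.sum_const, Finset.card_univ, Fintype.card_fin, nsmul_eq_mul]
          ring
  · rw [M.noiseMeanRisk_eq hE hA hS hdet hω hinj, add_sub_cancel_right]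
    calc 1 / b * (M.noiseVar * ((K : ℝ) / (n : ℝ)))
        = M.noiseVar * ∑ _k : Fin K, 1 / (b * n) := by
          rw [Finset.sum_const, Finset.card_univ, Fintype.card_fin, nsmul_eq_mul]
          field_simp
      _ ≤ _ := mul_le_mul_of_nonneg_left (Finset.sum_le_sum fun k _ =>
          le_leftInv_row (by positivity) hinj hV.upper k) M.noiseVar_nonneg

theorem measureReal_exists_leftInv_dataε_le {c : NNReal}
    (hε : ∀ i, HasSubgaussianMGF (M.ε (some i)) c P) (S : Matrix (Fin K) (Fin K) ℝ) (a : ℝ)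
    (hn : 0 < n) (hKn : K ≤ n) :
    P.real {ω | ∃ k,
      leftInv (M.whitenedData S ω) k ⬝ᵥ leftInv (M.whitenedData S ω) k ≤ 1 / (a * n) ∧
      4 * c / a * (Real.log n / n) < (leftInv (M.whitenedData S ω) k ⬝ᵥ M.dataε ω) ^ 2} ≤
      2 / n := by
  have hn0 : (0 : ℝ) < n := by exact_mod_cast hn
  have hexp : Real.exp (-(2 * Real.log n)) = ((n : ℝ) ^ 2)⁻¹ := by
    rw [Real.exp_neg, two_mul, Real.exp_add, Real.exp_log hn0, sq]
  have hlevel : 4 * c / a * (Real.log n / n) = 2 * c * (1 / (a * n)) * (2 * Real.log n) := by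
    ring
  rw [Set.ofPred_exists, hlevel]
  calc _ ≤ _ := measureReal_iUnion_fintype_le _
    _ ≤ ∑ _k : Fin K, 2 * Real.exp (-(2 * Real.log n)) := Finset.sum_le_sum fun k _ =>
        M.measureReal_leftInv_dataε_le hε S (by positivity) k
    _ = K * (2 * ((n : ℝ) ^ 2)⁻¹) := by
        rw [hexp, Finset.sum_const, Finset.card_univ, Fintype.card_fin, nsmul_eq_mul]
    _ ≤ n * (2 * ((n : ℝ) ^ 2)⁻¹) := by gcongr
    _ = 2 / n := by field_simp

theorem measureReal_not_riskBounds_le_of_whitened (hE : M.covE = 0) (hA : M.A.rank = K)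
    (hS : S * Sᵀ = M.covZ) (hdet : IsUnit S.det) {T : ℝ} (hT : 1 ≤ T)
    (hpsi : ∀ i, IsotropicPsi2Bound P (M.whitened S i) T) {c : NNReal}
    (hε : ∀ i, HasSubgaussianMGF (M.ε i) c P) (hc : (c : ℝ) = 2 * T ^ 2 * M.noiseVar)
    (hn : 0 < n) (hKn : K ≤ n) (hratio : sampleRatio T * K ≤ n) :
    P.real {ω | ¬ M.RiskBounds (128 * T ^ 2) (1 / (8 * T ^ 2)) ω} ≤ (64 * T ^ 4 + 2) / n := by
  have : (0 : ℝ) < n := by exact_mod_cast hn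
  let featureNoise : Set Ω := {ω | ¬ ∀ i, M.E i ω = 0}
  let illConditioned : Set Ω :=
    {ω | ¬ GramBounds (M.whitenedData S ω) (1 / 16 * n) (8 * T ^ 2 * n)}
  let largeNoise : Set Ω := {ω | ∃ k,
    leftInv (M.whitenedData S ω) k ⬝ᵥ leftInv (M.whitenedData S ω) k ≤ 1 / (1 / 16 * n) ∧
    4 * c / (1 / 16) * (Real.log n / n) <
      (leftInv (M.whitenedData S ω) k ⬝ᵥ M.dataε ω) ^ 2}
  have hlevel : 4 * c / (1 / 16) = 128 * T ^ 2 * M.noiseVar := by rw [hc]; ring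
  have hsub : {ω | ¬ M.RiskBounds (128 * T ^ 2) (1 / (8 * T ^ 2)) ω} ⊆
      featureNoise ∪ (illConditioned ∪ largeNoise) := by
    intro ω hω
    by_contra hgood
    simp only [Set.mem_union, not_or] at hgood
    obtain ⟨hE0, hV, hnoise⟩ := hgood
    replace hV := not_not.1 hV
    refine hω (M.riskBounds_of_gramBounds hE hA hS hdet (not_not.1 hE0) hn (by norm_num)
      (by positivity) hV fun k => ?_)
    rw [← hlevel]
    exact not_lt.1 fun hlt => hnoise ⟨k, leftInv_row_le (by positivity) hV.lower k, hlt⟩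
  have hfeature : P.real featureNoise = 0 := by
    rw [Measure.real, ae_iff.1 (M.ae_E_eq_zero hE), ENNReal.toReal_zero]
  calc _ ≤ P.real (featureNoise ∪ (illConditioned ∪ largeNoise)) := measureReal_mono hsub
    _ ≤ P.real featureNoise + (P.real illConditioned + P.real largeNoise) :=
        (measureReal_union_le _ _).trans (by gcongr; exact measureReal_union_le _ _)
    _ ≤ 0 + (64 * T ^ 4 / n + 2 / n) := add_le_add hfeature.le
        (add_le_add (M.measureReal_not_gramBounds_whitenedData_le hT hpsi hn hratio)
          (M.measureReal_exists_leftInv_dataε_le (fun i => hε (some i)) S _ hn hKn))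
    _ = (64 * T ^ 4 + 2) / n := by ring

theorem measureReal_not_riskBounds_le (hE : M.covE = 0) (hM : M.FullRank) {L T : ℝ}
    (hsub : M.IsSubGaussian L) (hLT : L < T) (hT : 1 ≤ T) (hn : sampleRatio T * K < n) :
    P.real {ω | ¬ M.RiskBounds (128 * T ^ 2) (1 / (8 * T ^ 2)) ω} ≤ (64 * T ^ 4 + 2) / n := by
  obtain ⟨⟨S, Zt, hpsd, hSS, hZt, hZ, -, hpsiZ⟩, εt, hεt, hε, hmean, hpsiε⟩ := hsub
  have hT0 : 0 < T := by linarith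
  have hsymm : Sᵀ = S := by
    simpa [Matrix.conjTranspose_eq_transpose_of_trivial] using hpsd.isHermitian.eq
  have hS : S * Sᵀ = M.covZ := by rw [hsymm, hSS]
  have hdet : IsUnit S.det :=
    isUnit_det_of_rank_mul_transpose ((hS ▸ hM.2).trans (Fintype.card_fin K).symm)
  have hKn : (K : ℝ) < n :=
    (le_mul_of_one_le_left (Nat.cast_nonneg K) (one_le_sampleRatio hT)).trans_lt hn
  have hc : ((M.noiseVar.toNNReal * (2 * T.toNNReal ^ 2) : NNReal) : ℝ) =
      2 * T ^ 2 * M.noiseVar := by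
    push_cast
    rw [Real.coe_toNNReal _ M.noiseVar_nonneg, Real.coe_toNNReal _ hT0.le, mul_comm]
  exact M.measureReal_not_riskBounds_le_of_whitened hE hM.1 hS hdet hT
    (M.isotropicPsi2Bound_whitened hS hdet hT0 hLT hZt hZ hpsiZ)
    (M.hasSubgaussianMGF_ε hT0 hεt hε hmean
      (hpsiε.trans_lt ((ENNReal.ofReal_lt_ofReal_iff hT0).2 hLT))) hc
    (by exact_mod_cast (Nat.cast_nonneg K).trans_lt hKn) (by exact_mod_cast hKn.le) hn.le

end Model

end FactorRegression

open FactorRegression in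
theorem mainTheorem3 :
    -- Part 1: equality of the realizable and the oracle prediction, and of their risks
    (∀ {Ω : Type*} [MeasurableSpace Ω] (P : Measure Ω) [IsProbabilityMeasure P] (n p K : ℕ)
      (M : Model P n p K), M.covE = 0 → M.FullRank →
      ∀ᵐ ω ∂P, (M.dataZ ω).rank = K →
        M.X none ω ⬝ᵥ M.αHat ω = M.Z none ω ⬝ᵥ M.βHat ω ∧
        M.risk (M.αHat ω) = ∫ ω', (M.Z none ω' ⬝ᵥ M.βHat ω - M.y none ω') ^ 2 ∂P) ∧
    -- Part 2: the constants depend only on the bound `L` on the sub-Gaussian norms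
    (∀ L : ℝ, 0 < L → ∃ C c c₁ c₂ : ℝ, 0 < C ∧ 0 < c ∧ 0 < c₁ ∧ 0 < c₂ ∧
      ∀ {Ω : Type*} [MeasurableSpace Ω] (P : Measure Ω) [IsProbabilityMeasure P] (n p K : ℕ)
        (M : Model P n p K), M.covE = 0 → M.FullRank → M.IsSubGaussian L →
        C * (K : ℝ) < (n : ℝ) →
        -- the (outer) probability that one of the claims fails is at most `c / n`
        P.real {ω | ¬ ((M.dataZ ω).rank = K ∧
            M.risk (M.αHat ω) - M.noiseVar ≤
              c₁ * (M.noiseVar * ((K : ℝ) * Real.log (n : ℝ) / (n : ℝ))) ∧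
            Integrable (M.riskResampled ω) P ∧
            M.noiseMeanRisk ω - M.noiseVar ≥
              c₂ * (M.noiseVar * ((K : ℝ) / (n : ℝ))))} ≤ c / (n : ℝ)) := by
  refine ⟨fun P _ n p K M hE hM => M.ae_prediction_eq_and_risk_eq hE hM.1, fun L hL => ?_⟩
  have hT : 1 ≤ L + 1 := by linarith
  refine ⟨sampleRatio (L + 1), 64 * (L + 1) ^ 4 + 2, 128 * (L + 1) ^ 2, 1 / (8 * (L + 1) ^ 2),
    zero_lt_one.trans_le (one_le_sampleRatio hT), by positivity, by positivity, by positivity, ?_⟩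
  intro Ω _ P _ n p K M hE hM hsub hn
  exact M.measureReal_not_riskBounds_le hE hM hsub (lt_add_one L) hT hn
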